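/- **Setting.** Let $\mathbf x=(X_1,\dots,X_p)$ be a vector of $p$ real features and $\mathbf y\in\mathbb R^q$ a response. For random vectors $\mathbf u\in\mathbb R^{d}$, $\mathbf v\in\mathbb R^{e}$ put $$\mathrm{Pcov}(\mathbf u,\mathbf v)^2=\iiint\big(F_{U,V}(u,v)-F_U(u)F_V(v)\big)^2\,dF_{U,V}(u,v)\,d\alpha\,d\beta,\qquad U=\alpha^{T}\mathbf u,\ V=\beta^{T}\mathbf v,$$ where $\alpha,\beta$ run through the unit spheres of $\mathbb R^d,\mathbb R^e$ with surface measure, and $$\mathrm{PC}(\mathbf u,\mathbf v)^2=\frac{\mathrm{Pcov}(\mathbf u,\mathbf v)^2}{\mathrm{Pcov}(\mathbf u,\mathbf u)\,\mathrm{Pcov}(\mathbf v,\mathbf v)},\qquad 0/0=0 .$$ Given samples $\mathbf U=(\mathbf u_1,\dots,\mathbf u_n)$ and $\mathbf V=(\mathbf v_1,\dots,\mathbf v_n)$, let $$a_{klr}=\arccos\frac{(\mathbf u_k-\mathbf u_r)^{T}(\mathbf u_l-\mathbf u_r)}{\|\mathbf u_k-\mathbf u_r\|\,\|\mathbf u_l-\mathbf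 u_r\|},\qquad a_{klr}=0\ \text{ if } k=r \text{ or } l=r,$$ $$A_{klr}=a_{klr}-n^{-1}\sum_{l'}a_{kl'r}-n^{-1}\sum_{k'}a_{k'lr}+n^{-2}\sum_{k',l'}a_{k'l'r},$$ let $b_{klr},B_{klr}$ be formed in the same way from $\mathbf V$, and put $\widehat{\mathrm{Pcov}}(\mathbf U,\mathbf V)^2=n^{-3}\sum_{k,l,r}A_{klr}B_{klr}$ and $\widehat{\mathrm{PC}}(\mathbf U,\mathbf V)^2=\widehat{\mathrm{Pcov}}(\mathbf U,\mathbf V)^2/\{\widehat{\mathrm{Pcov}}(\mathbf U,\mathbf U)\,\widehat{\mathrm{Pcov}}(\mathbf V,\mathbf V)\}$. Let $\mathcal A$ be the set of active features, i.e. of those $k$ for which the conditional distribution $F(\mathbf y\mid\mathbf x)$ functionally depends on $X_k$ (no version of it is free of $X_k$); let $s=|\mathcal A|$ and $\omega_k=\mathrm{PC}(X_k,\mathbf y)^2$. From $n$ i.i.d. copies of $(\mathbf x,\mathbf y)$ compute $\hat\omega_k$, the squared sample projection correlation of the $k$-th feature and the response. For a threshold $\delta$, PC-Screen selects $\hat{\mathcal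 A}(\delta)=\{k:\hat\omega_k\ge\delta\}$. **Theorem (sure screening).** Fix $q$, $\sigma_0>0$, $c_3>0$ and $0\le\kappa<1/2$. There are constants $C>0$ and $c_4>0$, depending only on $q,\sigma_0,c_3,\kappa$, with the following property. Let $n\ge1$, let $p$ and the law of $(\mathbf x,\mathbf y)$ be arbitrary (they may change with $n$), and suppose that * the distributions of $\mathbf y$ and of each active $X_k$ have no atoms; * $\mathrm{Pcov}(X_k,X_k)^2\ge\sigma_0^2$ for all $k\le p$, and $\mathrm{Pcov}(Y_j,Y_j)^2\ge\sigma_0^2$ for every coordinate $Y_j$ of $\mathbf y$; * (minimum signal strength) $\min_{k\in\mathcal A}\omega_k\ge 2c_3n^{-\kappa}$. Then, for every $\delta\le\min_{k\in\mathcal A}\omega_k/2$, $$\Pr\big(\mathcal A\subseteq\hat{\mathcal A}(\delta)\big)\ \ge\ 1-C\,s\,\exp\{-c_4n^{1-2\kappa}\}.$$ -/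

import Mathlib

open MeasureTheory ProbabilityTheory

noncomputable section

namespace PCScreen

/-- The Euclidean space `ℝ^d`. -/
abbrev Euc (d : ℕ) : Type := EuclideanSpace ℝ (Fin d)

/-- A real number, seen as a vector of `ℝ^1`. -/
def scalar (t : ℝ) : Euc 1 := WithLp.toLp 2 (fun _ => t)

/-! ### Population quantities -/

/-- The surface measure on the unit sphere of `ℝ^d` (for `d = 1`: unit mass at each of `±1`). -/
def surface (d : ℕ) : Measure (Metric.sphere (0 : Euc d) 1) :=
  (volume : Measure (Euc d)).toSphere

/-- The joint law of the projections `(U, V) = (αᵀ x, βᵀ y)` when `(x, y)` has law `P`. -/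
def projLaw {d e : ℕ} (P : Measure (Euc d × Euc e)) (α : Euc d) (β : Euc e) :
    Measure (ℝ × ℝ) :=
  P.map (fun z => (inner ℝ α z.1, inner ℝ β z.2))

/-- The squared projection covariance `Pcov(x, y)²` of a pair `(x, y)` with law `P`:
`∭ (F_{U,V}(u,v) - F_U(u) F_V(v))² dF_{U,V}(u,v) dα dβ`, where `U = αᵀ x`, `V = βᵀ y`, and `α`, `β`
run through the unit spheres. The integrand is bounded and all the measures are finite. -/
def pcovSq {d e : ℕ} (P : Measure (Euc d × Euc e)) : ℝ :=
  ∫ α, ∫ β, ∫ uv,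
      ((projLaw P α β).real (Set.Iic uv.1 ×ˢ Set.Iic uv.2)
        - (projLaw P α β).fst.real (Set.Iic uv.1) * (projLaw P α β).snd.real (Set.Iic uv.2)) ^ 2
    ∂(projLaw P (α : Euc d) (β : Euc e)) ∂(surface e) ∂(surface d)

/-- `Pcov(x, x)²` for a random vector `x` with law `Q`. -/
def pvarSq {d : ℕ} (Q : Measure (Euc d)) : ℝ :=
  pcovSq (Q.map (fun x => (x, x)))

/-- The squared projection correlation `PC(x, y)² = Pcov(x, y)² / (Pcov(x, x) Pcov(y, y))` of a
pair `(x, y)` with law `P`, with the convention `0 / 0 = 0`. -/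
def pcSq {d e : ℕ} (P : Measure (Euc d × Euc e)) : ℝ :=
  pcovSq P / (√(pvarSq P.fst) * √(pvarSq P.snd))

/-! ### Sample quantities -/

/-- `a_{klr}`: the angle at the `r`-th observation between the directions of the `k`-th and the
`l`-th one, and `0` if `k = r` or `l = r`. -/
def angleArr {n d : ℕ} (x : Fin n → Euc d) (k l r : Fin n) : ℝ :=
  if k = r ∨ l = r then 0
  else Real.arccos (inner ℝ (x k - x r) (x l - x r) / (‖x k - x r‖ * ‖x l - x r‖))

/-- The doubly centred array
`A_{klr} = a_{klr} - n⁻¹ ∑_l a_{klr} - n⁻¹ ∑_k a_{klr} + n⁻² ∑_k ∑_l a_{klr}`. -/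
def centredArr {n d : ℕ} (x : Fin n → Euc d) (k l r : Fin n) : ℝ :=
  angleArr x k l r - (n : ℝ)⁻¹ * ∑ l', angleArr x k l' r - (n : ℝ)⁻¹ * ∑ k', angleArr x k' l r
    + ((n : ℝ) ^ 2)⁻¹ * ∑ k', ∑ l', angleArr x k' l' r

/-- The squared sample projection covariance `n⁻³ ∑_{k,l,r} A_{klr} B_{klr}`. -/
def samplePcovSq {n d e : ℕ} (x : Fin n → Euc d) (y : Fin n → Euc e) : ℝ :=
  ((n : ℝ) ^ 3)⁻¹ * ∑ k, ∑ l, ∑ r, centredArr x k l r * centredArr y k l r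

/-- The squared sample projection correlation, with the convention `0 / 0 = 0`. -/
def samplePcSq {n d e : ℕ} (x : Fin n → Euc d) (y : Fin n → Euc e) : ℝ :=
  samplePcovSq x y / (√(samplePcovSq x x) * √(samplePcovSq y y))

/-! ### Features and response

A law `P` on `ℝ^p × ℝ^q` is the joint law of the features `(X_1, …, X_p)` and the response. -/

/-- The law of the `k`-th feature. -/
def featureLaw {p q : ℕ} (P : Measure ((Fin p → ℝ) × Euc q)) (k : Fin p) : Measure (Euc 1) :=
  P.map (fun z => scalar (z.1 k))

/-- The law of the `j`-th coordinate of the response. -/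
def responseCoordLaw {p q : ℕ} (P : Measure ((Fin p → ℝ) × Euc q)) (j : Fin q) :
    Measure (Euc 1) :=
  P.map (fun z => scalar (z.2 j))

/-- `ω_k = PC(X_k, y)²`, the squared projection correlation of the `k`-th feature and the whole
response vector. -/
def omega {p q : ℕ} (P : Measure ((Fin p → ℝ) × Euc q)) (k : Fin p) : ℝ :=
  pcSq (P.map (fun z => (scalar (z.1 k), z.2)))

/-- The conditional distribution of the response given the features does not functionally depend
on `X_k`: some version `F(· | x)` of it does not change when only the `k`-th coordinate of `x`
does. -/
def IsInactive {p q : ℕ} (P : Measure ((Fin p → ℝ) × Euc q)) (k : Fin p) : Prop :=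
  ∃ F : Kernel (Fin p → ℝ) (Euc q), IsMarkovKernel F ∧ P = P.fst ⊗ₘ F ∧
    ∀ (x : Fin p → ℝ) (t : ℝ), F (Function.update x k t) = F x

open scoped Classical in
/-- The set of active features: those on which `F(y | x)` functionally depends. -/
def activeSet {p q : ℕ} (P : Measure ((Fin p → ℝ) × Euc q)) : Finset (Fin p) :=
  Finset.univ.filter (fun k => ¬ IsInactive P k)

/-- `ω̂_k`, the squared sample projection correlation of the `k`-th feature and the response, for
the sample `z`. -/
def omegaHat {n p q : ℕ} (z : Fin n → (Fin p → ℝ) × Euc q) (k : Fin p) : ℝ :=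
  samplePcSq (fun i => scalar ((z i).1 k)) (fun i => (z i).2)

open scoped Classical in
/-- The set of features that are selected at the threshold `δ`. -/
def screenedSet {n p q : ℕ} (z : Fin n → (Fin p → ℝ) × Euc q) (δ : ℝ) : Finset (Fin p) :=
  Finset.univ.filter (fun k => δ ≤ omegaHat z k)

/-- The law of a random vector is continuous in the weak sense that it has no atoms: two
independent copies of the vector are almost surely distinct. For the response and all active
features, so that the angles in the sample quantities are almost surely well defined. -/
structure NoTies {p q : ℕ} (P : Measure ((Fin p → ℝ) × Euc q)) : Prop where
  feature : ∀ k ∈ activeSet P, ∀ v, featureLaw P k {v} = 0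
  response : ∀ v, P.snd {v} = 0

/-- The non-degenerate case: all scalar features and all coordinates of the response have squared
projection variance at least `σ₀²`. -/
structure Nondegenerate {p q : ℕ} (σ₀ : ℝ) (P : Measure ((Fin p → ℝ) × Euc q)) : Prop where
  feature : ∀ k, σ₀ ^ 2 ≤ pvarSq (featureLaw P k)
  response : ∀ j, σ₀ ^ 2 ≤ pvarSq (responseCoordLaw P j)

/-- Minimum signal strength: `min_{k ∈ A} ω_k ≥ 2 c₃ n^{-κ}`. -/
def MinSignal {p q : ℕ} (c₃ κ : ℝ) (n : ℕ) (P : Measure ((Fin p → ℝ) × Euc q)) : Prop :=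
  ∀ k ∈ activeSet P, 2 * c₃ * (n : ℝ) ^ (-κ) ≤ omega P k

end PCScreen

end

noncomputable section

namespace PCScreen

/-! Only one kind of failure has to be excluded: an active feature whose sample projection
correlation is less than half of its population value. A union bound over the active features then
finishes, so the work lies in an exponential bound for a single pair,
`exists_measure_samplePcSq_lt_le`, with constants uniform over all laws without atoms.

The population quantity integrates over directions, whereas the sample quantity contains plane
angles. The link is `sigma_inner_le_and_le`: the directions that make non-acute angles with two
nonzero vectors have measure proportional to π minus the angle between them. Writing the squared
covariance as an expectation over four further copies and integrating out the directions by Fubini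
gives `pcovSq_eq`: the squared projection covariance is a dimensional constant times the mean
`popAngle` of a bounded kernel in five independent observations. Absence of atoms makes the vectors
involved nonzero almost surely. The constants cancel in the correlation (`pcSq_eq`).

On the sample side, double centring is an averaging, so the sample covariance is exactly the
V-statistic of the same kernel (`samplePcovSq_eq_vStat`). Its bias is of order 1/n, since few index
tuples have repetitions, and one observation influences it by order 1/n, so McDiarmid's inequality
yields deviations of size η with probability at most 2 exp(-c η² n).

To pass to the ratio, the denominators must stay away from zero. For a law without atoms
`exists_pvarSq_ge` gives a lower bound that depends on the dimension only. For equal directions the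
covariance of the two indicators is F(1 - F), with F the distribution function of the projection
evaluated at a copy; its mean is bounded below because F is continuous. For nearby directions the
error is the probability of a thin band about a hyperplane, which is small on average over the
directions. With denominators bounded below and the signal at least 2c₃ n^(-κ), deviations of order
n^(-κ) are harmless to the factor 1/2, and η² n becomes a multiple of n^(1-2κ). -/

instance (d : ℕ) : IsFiniteMeasure (surface d) := by
  unfold surface; infer_instance

/-! ### Surface measure: isometry invariance and null hyperplane sections -/

/-- The action of a linear isometry on the unit sphere. -/
def sphereMap {d : ℕ} (R : Euc d ≃ₗᵢ[ℝ] Euc d) (α : Metric.sphere (0 : Euc d) 1) :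
    Metric.sphere (0 : Euc d) 1 :=
  ⟨R α, by simp⟩

/-- The surface measure of a set is, up to the factor `d`, the volume of the cone over it. An
isometry carries cones to cones and preserves volume. -/
lemma surface_preimage_isometry {d : ℕ} (R : Euc d ≃ₗᵢ[ℝ] Euc d) {H : Set (Euc d)}
    (hH : MeasurableSet H) :
    surface d {α | R (α : Euc d) ∈ H} = surface d {α | (α : Euc d) ∈ H} := by
  have h1 : MeasurableSet {α : Metric.sphere (0 : Euc d) 1 | (α : Euc d) ∈ H} :=
    measurable_subtype_coe hH
  have h2 : MeasurableSet {α : Metric.sphere (0 : Euc d) 1 | R (α : Euc d) ∈ H} :=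
    (R.continuous.measurable.comp measurable_subtype_coe) hH
  unfold surface
  rw [Measure.toSphere_apply' _ h1, Measure.toSphere_apply' _ h2]
  congr 1
  conv_rhs => rw [← R.measurePreserving.measure_preimage_emb R.toHomeomorph.measurableEmbedding]
  congr 1
  ext x
  simp only [Set.mem_smul, Set.mem_image, Set.mem_preimage, Set.mem_ofPred_eq]
  constructor
  · rintro ⟨t, ht, _, ⟨α, hα, rfl⟩, rfl⟩
    exact ⟨t, ht, R α, ⟨sphereMap R α, hα, rfl⟩, by simp⟩
  · rintro ⟨t, ht, _, ⟨α, hα, rfl⟩, hx⟩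
    refine ⟨t, ht, R.symm α, ⟨sphereMap R.symm α, by simpa [sphereMap] using hα, rfl⟩, ?_⟩
    apply R.injective
    simpa using hx

open scoped Pointwise in
-- The cone over the section lies in the orthogonal complement of `u`, a proper subspace and hence
-- of volume zero.
lemma surface_hyperplane {d : ℕ} {u : Euc d} (hu : u ≠ 0) :
    surface d {α | inner ℝ (α : Euc d) u = 0} = 0 := by
  have h1 : MeasurableSet {α : Metric.sphere (0 : Euc d) 1 | inner ℝ (α : Euc d) u = 0} :=
    measurableSet_eq_fun (by fun_prop) measurable_const
  unfold surface
  rw [Measure.toSphere_apply' _ h1]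
  have : volume (Set.Ioo (0 : ℝ) 1 • (Subtype.val '' {α : Metric.sphere (0 : Euc d) 1 |
      inner ℝ (α : Euc d) u = 0})) = 0 := by
    refine measure_mono_null (t := (((ℝ ∙ u)ᗮ : Submodule ℝ (Euc d)) : Set (Euc d))) ?_ ?_
    · rintro x ⟨t, ht, _, ⟨α, hα, rfl⟩, rfl⟩
      simp only [SetLike.mem_coe, Submodule.mem_orthogonal_singleton_iff_inner_left]
      simp only [Set.mem_ofPred_eq] at hα
      simp [inner_smul_left, hα]
    · apply Measure.addHaar_submodule
      intro h
      rw [Submodule.orthogonal_eq_top_iff] at h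
      exact hu (by simpa using h)
  rw [this, mul_zero]

/-- The real surface measure of the directions that satisfy `p`. -/
def sigma {d : ℕ} (p : Euc d → Prop) : ℝ := (surface d).real {α | p α}

lemma sigma_isometry {d : ℕ} (R : Euc d ≃ₗᵢ[ℝ] Euc d) {p : Euc d → Prop}
    (hp : MeasurableSet {x | p x}) : sigma (fun x => p (R x)) = sigma p := by
  unfold sigma Measure.real
  exact congrArg _ (surface_preimage_isometry R hp)

lemma sigma_nonneg {d : ℕ} (p : Euc d → Prop) : 0 ≤ sigma p := measureReal_nonneg

lemma sigma_mono {d : ℕ} {p r : Euc d → Prop} (h : ∀ x, p x → r x) : sigma p ≤ sigma r :=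
  measureReal_mono (fun x hx => h x hx)

lemma sigma_add {d : ℕ} {p r : Euc d → Prop} (h : ∀ x, ¬ (p x ∧ r x))
    (hr : MeasurableSet {x | r x}) :
    sigma (fun x => p x ∨ r x) = sigma p + sigma r :=
  measureReal_union (Set.disjoint_left.2 fun x hx hx' => h x ⟨hx, hx'⟩)
    (measurable_subtype_coe hr)

/-- Two conditions that only differ on a hyperplane have the same measure. -/
lemma sigma_congr_hyperplane {d : ℕ} {u : Euc d} (hu : u ≠ 0) {p r : Euc d → Prop}
    (h : ∀ x, inner ℝ x u ≠ 0 → (p x ↔ r x)) : sigma p = sigma r := by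
  have h0 : ∀ᵐ (α : Metric.sphere (0 : Euc d) 1) ∂(surface d), inner ℝ (α : Euc d) u ≠ 0 := by
    rw [ae_iff]; simpa using surface_hyperplane hu
  unfold sigma Measure.real
  exact congrArg ENNReal.toReal (measure_congr (h0.mono fun α hα => propext (h α hα)))

lemma measurableSet_inner_le {d : ℕ} (u : Euc d) : MeasurableSet {x : Euc d | inner ℝ x u ≤ 0} :=
  measurableSet_le (by fun_prop) measurable_const

lemma measurableSet_inner_pos_and_le {d : ℕ} (u v : Euc d) :
    MeasurableSet {x : Euc d | 0 < inner ℝ x u ∧ inner ℝ x v ≤ 0} := by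
  refine MeasurableSet.inter (s₁ := {x : Euc d | 0 < inner ℝ x u}) ?_ (measurableSet_inner_le v)
  exact measurableSet_lt measurable_const (by fun_prop)

lemma measurableSet_inner_pos {d : ℕ} (u : Euc d) : MeasurableSet {x : Euc d | 0 < inner ℝ x u} :=
  measurableSet_lt measurable_const (by fun_prop)

/-! ### Lunes, and the measure of an intersection of two half-spaces -/

/-- The rotation by the angle `s` in the plane of an orthonormal pair `u`, `v`. -/
def planeRotation {d : ℕ} (u v : Euc d) (s : ℝ) : Euc d →ₗ[ℝ] Euc d :=
  LinearMap.id
    + (LinearMap.toSpanSingleton ℝ (Euc d) u).comp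
        ((Real.cos s - 1) • (innerₛₗ ℝ u) - Real.sin s • (innerₛₗ ℝ v))
    + (LinearMap.toSpanSingleton ℝ (Euc d) v).comp
        (Real.sin s • (innerₛₗ ℝ u) + (Real.cos s - 1) • (innerₛₗ ℝ v))

lemma planeRotation_apply {d : ℕ} (u v : Euc d) (s : ℝ) (x : Euc d) :
    planeRotation u v s x = x
      + ((Real.cos s - 1) * inner ℝ u x - Real.sin s * inner ℝ v x) • u
      + (Real.sin s * inner ℝ u x + (Real.cos s - 1) * inner ℝ v x) • v := by
  simp [planeRotation]

lemma norm_planeRotation {d : ℕ} {u v : Euc d} (hu : inner ℝ u u = 1) (hv : inner ℝ v v = 1)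
    (huv : inner ℝ u v = 0) (s : ℝ) (x : Euc d) : ‖planeRotation u v s x‖ = ‖x‖ := by
  have hvu : inner ℝ v u = 0 := by rw [real_inner_comm]; exact huv
  have hxu := real_inner_comm u x
  have hxv := real_inner_comm v x
  rw [← sq_eq_sq₀ (norm_nonneg _) (norm_nonneg _), ← real_inner_self_eq_norm_sq,
    ← real_inner_self_eq_norm_sq, planeRotation_apply]
  simp only [inner_add_left, inner_add_right, inner_smul_left, inner_smul_right, hu, hv, huv, hvu,
    hxu, hxv, RCLike.conj_to_real]
  linear_combination ((inner ℝ u x) ^ 2 + (inner ℝ v x) ^ 2) * Real.sin_sq_add_cos_sq s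

/-- The rotation by the angle `s` in the plane of an orthonormal pair, as an isometry. -/
def planeRotationEquiv {d : ℕ} {u v : Euc d} (hu : inner ℝ u u = 1) (hv : inner ℝ v v = 1)
    (huv : inner ℝ u v = 0) (s : ℝ) : Euc d ≃ₗᵢ[ℝ] Euc d :=
  LinearIsometry.toLinearIsometryEquiv
    ⟨planeRotation u v s, norm_planeRotation hu hv huv s⟩ rfl

/-- The unit vector at the angle `s` in the plane of the orthonormal pair `u`, `v`. -/
def planeVec {d : ℕ} (u v : Euc d) (s : ℝ) : Euc d := Real.cos s • u + Real.sin s • v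

lemma inner_planeVec {d : ℕ} (u v x : Euc d) (s : ℝ) :
    inner ℝ x (planeVec u v s) = Real.cos s * inner ℝ x u + Real.sin s * inner ℝ x v := by
  simp [planeVec, inner_add_right, inner_smul_right]

lemma inner_planeRotationEquiv {d : ℕ} {u v : Euc d} (hu : inner ℝ u u = 1) (hv : inner ℝ v v = 1)
    (huv : inner ℝ u v = 0) (s t : ℝ) (x : Euc d) :
    inner ℝ (planeRotationEquiv hu hv huv s x) (planeVec u v (s + t))
      = inner ℝ x (planeVec u v t) := by
  have hvu : inner ℝ v u = 0 := by rw [real_inner_comm]; exact huv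
  have hxu := real_inner_comm u x
  have hxv := real_inner_comm v x
  change inner ℝ (planeRotation u v s x) _ = _
  rw [inner_planeVec, inner_planeVec, planeRotation_apply]
  simp only [inner_add_left, inner_smul_left, hu, hv, huv, hvu, hxu, hxv, RCLike.conj_to_real]
  rw [Real.cos_add, Real.sin_add]
  linear_combination (inner ℝ u x * Real.cos t + inner ℝ v x * Real.sin t) *
    Real.sin_sq_add_cos_sq s

lemma planeVec_ne_zero {d : ℕ} {u v : Euc d} (hu : inner ℝ u u = 1) (hv : inner ℝ v v = 1)
    (huv : inner ℝ u v = 0) (s : ℝ) : planeVec u v s ≠ 0 := by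
  intro h
  have hvu : inner ℝ v u = 0 := by rw [real_inner_comm]; exact huv
  have h1 := inner_planeVec u v u s
  have h2 := inner_planeVec u v v s
  rw [h, hu, huv, inner_zero_right] at h1
  rw [h, hvu, hv, inner_zero_right] at h2
  nlinarith [Real.sin_sq_add_cos_sq s]

/-- The measure of the directions in the lune between the half-spaces at the angles `s`, `t`. -/
def lune {d : ℕ} (u v : Euc d) (s t : ℝ) : ℝ :=
  sigma (fun x => 0 < inner ℝ x (planeVec u v s) ∧ inner ℝ x (planeVec u v t) ≤ 0)

lemma lune_shift {d : ℕ} {u v : Euc d} (hu : inner ℝ u u = 1) (hv : inner ℝ v v = 1)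
    (huv : inner ℝ u v = 0) (s t : ℝ) : lune u v s (s + t) = lune u v 0 t := by
  unfold lune
  rw [← sigma_isometry (planeRotationEquiv hu hv huv s)
    (measurableSet_inner_pos_and_le _ _)]
  congr 1
  ext x
  rw [inner_planeRotationEquiv hu hv huv]
  conv_lhs => rw [show planeVec u v s = planeVec u v (s + 0) by simp]
  rw [inner_planeRotationEquiv hu hv huv]

/-- The intermediate half-space cuts the lune into two lunes, and the second is a rotated copy of
one that starts at the angle 0. -/
lemma lune_add {d : ℕ} {u v : Euc d} (hu : inner ℝ u u = 1) (hv : inner ℝ v v = 1)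
    (huv : inner ℝ u v = 0) {s t : ℝ} (hs : 0 < s) (ht : 0 < t) (hst : s + t < Real.pi) :
    lune u v 0 (s + t) = lune u v 0 s + lune u v 0 t := by
  rw [← lune_shift hu hv huv s t]
  unfold lune
  rw [← sigma_add _ (r := fun x => 0 < inner ℝ x _ ∧ inner ℝ x _ ≤ 0) (measurableSet_inner_pos_and_le _ _)]
  · congr 1
    ext x
    have h1 : 0 < Real.sin s := Real.sin_pos_of_pos_of_lt_pi hs (by linarith)
    have h2 : 0 < Real.sin t := Real.sin_pos_of_pos_of_lt_pi ht (by linarith)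
    have h3 : 0 < Real.sin (s + t) := Real.sin_pos_of_pos_of_lt_pi (by linarith) hst
    -- The intermediate normal is a combination of the outer two with positive coefficients, so the
    -- sign conditions on two of the products force the third.
    have key : Real.sin (s + t) * inner ℝ x (planeVec u v s)
        = Real.sin t * inner ℝ x (planeVec u v 0)
          + Real.sin s * inner ℝ x (planeVec u v (s + t)) := by
      simp only [inner_planeVec, Real.sin_add, Real.cos_add, Real.cos_zero, Real.sin_zero]
      linear_combination (Real.sin t * inner ℝ x u) * Real.sin_sq_add_cos_sq s
    generalize inner ℝ x (planeVec u v s) = b at *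
    generalize inner ℝ x (planeVec u v 0) = a at *
    generalize inner ℝ x (planeVec u v (s + t)) = c at *
    constructor
    · rintro ⟨ha, hc⟩
      rcases le_or_gt b 0 with hb | hb
      · exact Or.inl ⟨ha, hb⟩
      · exact Or.inr ⟨hb, hc⟩
    · rintro (⟨ha, hb⟩ | ⟨hb, hc⟩)
      · refine ⟨ha, ?_⟩
        by_contra hc
        push Not at hc
        nlinarith [mul_pos h2 ha, mul_pos h1 hc, mul_nonneg h3.le (neg_nonneg.2 hb)]
      · refine ⟨?_, hc⟩
        by_contra ha
        push Not at ha
        nlinarith [mul_pos h3 hb, mul_nonneg h1.le (neg_nonneg.2 hc),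
          mul_nonneg h2.le (neg_nonneg.2 ha)]
  · rintro x ⟨⟨-, h⟩, h', -⟩
    exact absurd h (not_le.2 h')

lemma sigma_neg {d : ℕ} {p : Euc d → Prop} (hp : MeasurableSet {x | p x}) :
    sigma (fun x => p (-x)) = sigma p :=
  sigma_isometry (LinearIsometryEquiv.neg ℝ) hp

/-- The antipodal map exchanges the open half-space with its complement up to a null hyperplane. -/
lemma sigma_inner_pos {d : ℕ} {w : Euc d} (hw : w ≠ 0) :
    sigma (fun x : Euc d => 0 < inner ℝ x w) = sigma (fun _ : Euc d => True) / 2 := by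
  have h1 : sigma (fun x : Euc d => inner ℝ x w ≤ 0) = sigma (fun x : Euc d => 0 < inner ℝ x w) := by
    rw [← sigma_neg (measurableSet_inner_pos w)]
    refine sigma_congr_hyperplane hw fun x hx => ?_
    rw [inner_neg_left, neg_pos]
    exact ⟨fun h => lt_of_le_of_ne h hx, le_of_lt⟩
  have h2 := sigma_add (p := fun x : Euc d => 0 < inner ℝ x w) (r := fun x => inner ℝ x w ≤ 0)
    (fun x hx => absurd hx.2 (not_le.2 hx.1)) (measurableSet_inner_le w)
  have h3 : (fun x : Euc d => 0 < inner ℝ x w ∨ inner ℝ x w ≤ 0) = fun _ => True := by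
    ext x; simp [lt_or_ge]
  rw [h3] at h2
  linarith

/-- The normal at the angle π is the negative of the normal at 0. Up to a null set the two lunes are
therefore the parts of the half-space at 0 on either side of the hyperplane at `s`. -/
lemma lune_add_compl {d : ℕ} {u v : Euc d} (hu : inner ℝ u u = 1) (hv : inner ℝ v v = 1)
    (huv : inner ℝ u v = 0) (s : ℝ) :
    lune u v 0 s + lune u v 0 (Real.pi - s) = sigma (fun _ : Euc d => True) / 2 := by
  rw [← sigma_inner_pos (planeVec_ne_zero hu hv huv 0), ← lune_shift hu hv huv s (Real.pi - s)]
  have h : lune u v s (s + (Real.pi - s)) = sigma (fun x => 0 < inner ℝ x (planeVec u v 0)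
      ∧ 0 < inner ℝ x (planeVec u v s)) := by
    refine sigma_congr_hyperplane (planeVec_ne_zero hu hv huv 0) fun x hx => ?_
    have : inner ℝ x (planeVec u v (s + (Real.pi - s))) = - inner ℝ x (planeVec u v 0) := by
      simp [inner_planeVec]
    rw [this, and_comm, neg_nonpos]
    exact and_congr_left fun _ => ⟨fun h => lt_of_le_of_ne h hx.symm, le_of_lt⟩
  rw [h]
  unfold lune
  rw [← sigma_add]
  · congr 1
    ext x
    rw [← and_or_left]
    simp [le_or_gt]
  · rintro x ⟨⟨-, h⟩, -, h'⟩
    exact absurd h (not_le.2 h')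
  · exact (measurableSet_inner_pos _).inter (measurableSet_inner_pos _)

lemma lune_mono {d : ℕ} {u v : Euc d} (hu : inner ℝ u u = 1) (hv : inner ℝ v v = 1)
    (huv : inner ℝ u v = 0) {s t : ℝ} (hs : 0 < s) (hst : s ≤ t) (ht : t < Real.pi) :
    lune u v 0 s ≤ lune u v 0 t := by
  rcases hst.eq_or_lt with rfl | h
  · exact le_rfl
  · have := lune_add hu hv huv hs (sub_pos.2 h) (by linarith)
    rw [add_sub_cancel] at this
    rw [this]
    have h0 : 0 ≤ lune u v 0 (t - s) := sigma_nonneg _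
    linarith

lemma lune_nat_mul {d : ℕ} {u v : Euc d} (hu : inner ℝ u u = 1) (hv : inner ℝ v v = 1)
    (huv : inner ℝ u v = 0) {s : ℝ} (hs : 0 < s) (k : ℕ) (hk : (k + 1) * s < Real.pi) :
    lune u v 0 ((k + 1) * s) = (k + 1) * lune u v 0 s := by
  induction k with
  | zero => simp
  | succ k ih =>
    push_cast at hk ⊢
    have hk' : ((k : ℝ) + 1) * s < Real.pi := by nlinarith
    have e : ((k : ℝ) + 1 + 1) * s = (k + 1) * s + s := by ring
    rw [e, lune_add hu hv huv (by positivity) hs (by rw [← e]; exact hk), ih hk']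
    ring

/-- An additive, monotone function of the angle is linear: additivity settles the rational multiples
of π, monotonicity the angles between them, and the complement identity fixes the slope. -/
lemma lune_eq {d : ℕ} {u v : Euc d} (hu : inner ℝ u u = 1) (hv : inner ℝ v v = 1)
    (huv : inner ℝ u v = 0) {s : ℝ} (hs : 0 < s) (hs' : s < Real.pi) :
    lune u v 0 s = s / (2 * Real.pi) * sigma (fun _ : Euc d => True) := by
  set V := sigma (fun _ : Euc d => True) with hV
  have hpi := Real.pi_pos
  -- The unit angle is π over the denominator `j + 2`. Here `j + 1` units and one unit are
  -- complementary, so one unit has measure V / 2 / (j + 2).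
  have hrat : ∀ p : ℚ, 0 < p → p < 1 → lune u v 0 (p * Real.pi) = p * V / 2 := by
    intro p hp hp1
    obtain ⟨k, hk⟩ : ∃ k : ℕ, p.num = k + 1 :=
      ⟨(p.num - 1).toNat, by have := Rat.num_pos.2 hp; omega⟩
    obtain ⟨m, hm⟩ : ∃ m : ℕ, p.den = m + 1 := ⟨p.den - 1, by have := p.den_pos; omega⟩
    have hpR : (p : ℝ) = (k + 1) / (m + 1) := by
      rw [Rat.cast_def, hk, hm]; push_cast; ring
    have hkm : k < m := by
      have : (p : ℝ) < 1 := by exact_mod_cast hp1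
      rw [hpR, div_lt_one (by positivity)] at this
      exact_mod_cast (by linarith : (k : ℝ) < m)
    obtain ⟨j, rfl⟩ : ∃ j, m = j + 1 := ⟨m - 1, by omega⟩
    have hs0 : 0 < Real.pi / (j + 2) := by positivity
    have h1 := lune_nat_mul hu hv huv hs0 j (by
      rw [mul_div_assoc', div_lt_iff₀ (by positivity)]; nlinarith)
    have h2 := lune_add_compl hu hv huv (Real.pi / (j + 2))
    have e : Real.pi - Real.pi / (j + 2) = (j + 1) * (Real.pi / (j + 2)) := by
      field_simp; ring
    rw [e, h1] at h2
    have hkj : (k : ℝ) + 1 ≤ j + 1 := by exact_mod_cast hkm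
    have h3 := lune_nat_mul hu hv huv hs0 k (by
      rw [mul_div_assoc', div_lt_iff₀ (by positivity)]; nlinarith)
    have e' : (p : ℝ) * Real.pi = (k + 1) * (Real.pi / (j + 2)) := by
      rw [hpR]; push_cast; field_simp; ring
    rw [e', h3, hpR]
    have h4 : lune u v 0 (Real.pi / (j + 2)) = V / 2 / (j + 2) := by
      rw [eq_div_iff (by positivity)]; linarith
    rw [h4]; push_cast; field_simp; ring
  have hV0 : 0 ≤ V := sigma_nonneg _
  have hl0 : 0 ≤ lune u v 0 s := sigma_nonneg _
  -- The squeeze divides by the total mass; if that vanishes, both sides are zero.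
  rcases hV0.eq_or_lt with h0 | hVpos
  · rw [← h0, mul_zero]
    refine le_antisymm ?_ hl0
    rw [h0]
    exact sigma_mono fun _ _ => trivial
  apply le_antisymm
  · by_contra! h
    have h' : s / Real.pi < min 1 (2 * lune u v 0 s / V) := by
      rw [lt_min_iff, div_lt_one hpi, lt_div_iff₀ hVpos]
      refine ⟨hs', ?_⟩
      have : s / Real.pi * V = 2 * (s / (2 * Real.pi) * V) := by field_simp
      linarith
    obtain ⟨p, hp, hp'⟩ := exists_rat_btwn h'
    obtain ⟨hp1, hp2⟩ := lt_min_iff.1 hp'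
    have hp0 : (0 : ℝ) < p := (div_pos hs hpi).trans hp
    have h3 := lune_mono hu hv huv hs ((div_lt_iff₀ hpi).1 hp).le (by nlinarith)
    rw [hrat p (by exact_mod_cast hp0) (by exact_mod_cast hp1)] at h3
    rw [lt_div_iff₀ hVpos] at hp2
    linarith
  · by_contra! h
    have h' : 2 * lune u v 0 s / V < s / Real.pi := by
      rw [div_lt_iff₀ hVpos]
      have : s / Real.pi * V = 2 * (s / (2 * Real.pi) * V) := by field_simp
      linarith
    obtain ⟨p, hp, hp'⟩ := exists_rat_btwn h'
    have hp0 : (0 : ℝ) < p := lt_of_le_of_lt (by positivity) hp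
    have hp1 : (p : ℝ) < 1 := hp'.trans ((div_lt_one hpi).2 hs')
    have h3 := lune_mono hu hv huv (mul_pos hp0 hpi) ((lt_div_iff₀ hpi).1 hp').le hs'
    rw [hrat p (by exact_mod_cast hp0) (by exact_mod_cast hp1)] at h3
    rw [div_lt_iff₀ hVpos] at hp
    linarith

/-- The measure of the directions that make obtuse angles with two given nonzero vectors. -/
lemma sigma_inner_le_and_le {d : ℕ} {x y : Euc d} (hx : x ≠ 0) (hy : y ≠ 0) :
    sigma (fun α : Euc d => inner ℝ α x ≤ 0 ∧ inner ℝ α y ≤ 0)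
      = sigma (fun _ : Euc d => True) / (2 * Real.pi)
        * (Real.pi - InnerProductGeometry.angle x y) := by
  have hpi := Real.pi_pos
  have hhalf : ∀ {w : Euc d}, w ≠ 0 → sigma (fun α : Euc d => inner ℝ α w ≤ 0)
      = sigma (fun _ : Euc d => True) / 2 := by
    intro w hw
    rw [← sigma_inner_pos (neg_ne_zero.2 hw)]
    refine sigma_congr_hyperplane hw fun α hα => ?_
    rw [inner_neg_right, neg_pos]
    exact ⟨fun h => lt_of_le_of_ne h hα, le_of_lt⟩
  set θ := InnerProductGeometry.angle x y with hθ
  rcases (InnerProductGeometry.angle_nonneg x y).eq_or_lt with h0 | h0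
  · obtain ⟨-, r, hr, rfl⟩ := InnerProductGeometry.angle_eq_zero_iff.1 h0.symm
    rw [hθ, ← h0, sub_zero]
    have : (fun α : Euc d => inner ℝ α x ≤ 0 ∧ inner ℝ α (r • x) ≤ 0)
        = fun α : Euc d => inner ℝ α x ≤ 0 := by
      ext α
      rw [inner_smul_right]
      exact and_iff_left_of_imp fun h => mul_nonpos_of_nonneg_of_nonpos hr.le h
    rw [this, hhalf hx]
    field_simp
  rcases (InnerProductGeometry.angle_le_pi x y).eq_or_lt with hp | hp
  · obtain ⟨-, r, hr, rfl⟩ := InnerProductGeometry.angle_eq_pi_iff.1 hp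
    rw [hθ, hp, sub_self, mul_zero]
    have : sigma (fun α : Euc d => inner ℝ α x ≤ 0 ∧ inner ℝ α (r • x) ≤ 0)
        = sigma (fun _ : Euc d => False) := by
      refine sigma_congr_hyperplane hx fun α hα => ?_
      rw [inner_smul_right, iff_false]
      rintro ⟨h1, h2⟩
      have := lt_of_le_of_ne h1 hα
      nlinarith
    rw [this]
    simp [sigma]
  have hsin : 0 < Real.sin θ := Real.sin_pos_of_pos_of_lt_pi h0 hp
  have hnx : ‖x‖ ≠ 0 := norm_ne_zero_iff.2 hx
  have hny : ‖y‖ ≠ 0 := norm_ne_zero_iff.2 hy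
  obtain ⟨u, hu_def⟩ : ∃ u : Euc d, u = ‖x‖⁻¹ • x := ⟨_, rfl⟩
  obtain ⟨w, hw_def⟩ : ∃ w : Euc d, w = ‖y‖⁻¹ • y := ⟨_, rfl⟩
  have huu : inner ℝ u u = 1 := by
    rw [hu_def, inner_smul_left, inner_smul_right, real_inner_self_eq_norm_sq]
    simp only [RCLike.conj_to_real]; field_simp
  have hww : inner ℝ w w = 1 := by
    rw [hw_def, inner_smul_left, inner_smul_right, real_inner_self_eq_norm_sq]
    simp only [RCLike.conj_to_real]; field_simp
  have huw : inner ℝ u w = Real.cos θ := by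
    rw [hθ, InnerProductGeometry.cos_angle, hu_def, hw_def, inner_smul_left, inner_smul_right]
    simp only [RCLike.conj_to_real]; field_simp
  have hwu : inner ℝ w u = Real.cos θ := by rw [real_inner_comm]; exact huw
  -- Gram–Schmidt: in the frame `u`, `v` the directions of `x` and `y` sit at the angles 0 and θ.
  obtain ⟨v, hv_def⟩ : ∃ v : Euc d, v = (Real.sin θ)⁻¹ • (w - Real.cos θ • u) := ⟨_, rfl⟩
  have huv : inner ℝ u v = 0 := by
    rw [hv_def, inner_smul_right, inner_sub_right, inner_smul_right, huu, huw]; simp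
  have hvv : inner ℝ v v = 1 := by
    rw [hv_def, inner_smul_right, inner_smul_left, inner_sub_right, inner_smul_right,
      inner_sub_left, inner_sub_left, inner_smul_left, inner_smul_left, huu, huw, hwu, hww]
    simp only [RCLike.conj_to_real]
    field_simp
    linear_combination -(Real.sin_sq_add_cos_sq θ)
  have hw0 : planeVec u v θ = w := by
    rw [planeVec, hv_def, smul_smul, mul_inv_cancel₀ hsin.ne', one_smul]; abel
  have hu0 : planeVec u v 0 = u := by simp [planeVec]
  have hl := lune_eq huu hvv huv h0 hp
  -- The half-space of `y` is split by the sign of the product with `x`; the positive part is the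
  -- lune of angle θ.
  have hsum := sigma_add (p := fun α : Euc d => inner ℝ α x ≤ 0 ∧ inner ℝ α y ≤ 0)
    (r := fun α : Euc d => 0 < inner ℝ α x ∧ inner ℝ α y ≤ 0)
    (fun α hα => absurd hα.1.1 (not_le.2 hα.2.1)) (measurableSet_inner_pos_and_le _ _)
  have e1 : (fun α : Euc d => (inner ℝ α x ≤ 0 ∧ inner ℝ α y ≤ 0) ∨
      (0 < inner ℝ α x ∧ inner ℝ α y ≤ 0)) = fun α => inner ℝ α y ≤ 0 := by
    ext α
    rw [← or_and_right]
    simp [le_or_gt]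
  have e2 : sigma (fun α : Euc d => 0 < inner ℝ α x ∧ inner ℝ α y ≤ 0) = lune u v 0 θ := by
    unfold lune
    congr 1
    ext α
    rw [hu0, hw0, hu_def, hw_def, inner_smul_right, inner_smul_right]
    have hx' : 0 < ‖x‖⁻¹ := inv_pos.2 (norm_pos_iff.2 hx)
    have hy' : 0 < ‖y‖⁻¹ := inv_pos.2 (norm_pos_iff.2 hy)
    rw [mul_pos_iff_of_pos_left hx', ← not_lt, ← not_lt, mul_pos_iff_of_pos_left hy']
  rw [e1, hhalf hy, e2, hl] at hsum
  have : sigma (fun _ : Euc d => True) / (2 * Real.pi) * (Real.pi - θ)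
      = sigma (fun _ : Euc d => True) / 2 - θ / (2 * Real.pi) * sigma (fun _ : Euc d => True) := by
    field_simp
  linarith

/-! ### McDiarmid's inequality -/

section BoundedDifferences

variable {S : Type*} [MeasurableSpace S]

lemma integral_pi_succ {n : ℕ} (Q : Measure S) [IsProbabilityMeasure Q] {F : (Fin (n + 1) → S) → ℝ}
    (hF : Integrable (fun z : S × (Fin n → S) => F (Fin.cons z.1 z.2))
      (Q.prod (Measure.pi fun _ => Q))) :
    ∫ x, F x ∂(Measure.pi fun _ : Fin (n + 1) => Q)
      = ∫ s, ∫ w, F (Fin.cons s w) ∂(Measure.pi fun _ : Fin n => Q) ∂Q := by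
  have h := (measurePreserving_piFinSuccAbove (fun _ : Fin (n + 1) => Q) 0).symm
  rw [← h.integral_comp', ← integral_prod _ hF]
  refine integral_congr_ae (ae_of_all _ fun z => congrArg F ?_)
  exact Fin.insertNth_zero (α := fun _ => S) z.1 z.2

lemma integrable_of_abs_le {Ω : Type*} [MeasurableSpace Ω] {μ : Measure Ω} [IsFiniteMeasure μ]
    {f : Ω → ℝ} (hf : Measurable f) {B : ℝ} (hB : ∀ x, |f x| ≤ B) : Integrable f μ :=
  Integrable.of_bound hf.aestronglyMeasurable B (ae_of_all _ hB)

lemma abs_integral_le_of_abs_le {Ω : Type*} [MeasurableSpace Ω] {μ : Measure Ω}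
    [IsProbabilityMeasure μ] {f : Ω → ℝ} {B : ℝ} (hB : ∀ x, |f x| ≤ B) : |∫ x, f x ∂μ| ≤ B := by
  simpa using norm_integral_le_of_norm_le_const (μ := μ) (f := f) (C := B) (ae_of_all _ hB)

lemma measurable_cons {n : ℕ} :
    Measurable fun z : S × (Fin n → S) => (Fin.cons z.1 z.2 : Fin (n + 1) → S) := by
  refine measurable_pi_lambda _ fun i => ?_
  refine Fin.cases ?_ (fun j => ?_) i
  · simpa using measurable_fst
  · simp only [Fin.cons_succ]
    fun_prop

/-- The exponential moment bound behind McDiarmid's inequality. -/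
lemma integral_exp_le_of_bounded_differences (Q : Measure S) [IsProbabilityMeasure Q] {c B : ℝ}
    (t : ℝ) (n : ℕ) :
    ∀ f : (Fin n → S) → ℝ, Measurable f → (∀ x, |f x| ≤ B) →
      (∀ x i s, |f (Function.update x i s) - f x| ≤ c) →
      ∫ x, Real.exp (t * (f x - ∫ y, f y ∂(Measure.pi fun _ => Q))) ∂(Measure.pi fun _ => Q)
        ≤ Real.exp (n * c ^ 2 * t ^ 2 / 2) := by
  induction n with
  | zero =>
    intro f _ _ _
    have : ∀ x, f x = f finZeroElim := fun x => congrArg f (Subsingleton.elim _ _)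
    simp [this]
  | succ n ih =>
    intro f hf hB hd
    set π := Measure.pi fun _ : Fin n => Q
    have hfc : Measurable fun z : S × (Fin n → S) => f (Fin.cons z.1 z.2) :=
      hf.comp measurable_cons
    have hfs : ∀ s, Measurable fun w : Fin n → S => f (Fin.cons s w) := fun s =>
      hfc.comp measurable_prodMk_left
    -- Conditional mean given the first coordinate. The deviation of `f` splits into `f - g`, left
    -- to the induction hypothesis in the remaining coordinates, and `g - m`, left to Hoeffding's
    -- lemma.
    set g : S → ℝ := fun s => ∫ w, f (Fin.cons s w) ∂π with hg
    have hgm : Measurable g := hfc.stronglyMeasurable.integral_prod_right'.measurable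
    have hmean : ∫ y, f y ∂(Measure.pi fun _ : Fin (n + 1) => Q) = ∫ s, g s ∂Q :=
      integral_pi_succ Q (integrable_of_abs_le hfc fun _ => hB _)
    set m := ∫ s, g s ∂Q with hm
    have hint : Integrable (fun z : S × (Fin n → S) => Real.exp (t * (f (Fin.cons z.1 z.2) - m)))
        (Q.prod π) := by
      refine integrable_of_abs_le (B := Real.exp (|t| * (B + |m|)))
        ((hfc.sub_const m).const_mul t).exp fun z => ?_
      rw [Real.abs_exp, Real.exp_le_exp]
      refine (le_abs_self _).trans ?_
      rw [abs_mul]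
      gcongr
      exact (abs_sub _ _).trans (by gcongr; exact hB _)
    rw [hmean, integral_pi_succ Q hint]
    have hgB : ∀ s s', |g s - g s'| ≤ c := by
      intro s s'
      rw [hg]
      simp only
      rw [← integral_sub (integrable_of_abs_le (hfs s) fun _ => hB _)
        (integrable_of_abs_le (hfs s') fun _ => hB _)]
      refine abs_integral_le_of_abs_le fun w => ?_
      have := hd (Fin.cons s' w) 0 s
      rwa [Fin.update_cons_zero] at this
    have hin : ∀ s, ∫ w, Real.exp (t * (f (Fin.cons s w) - m)) ∂π
        ≤ Real.exp (t * (g s - m)) * Real.exp (n * c ^ 2 * t ^ 2 / 2) := by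
      intro s
      have h1 := ih (fun w => f (Fin.cons s w)) (hfs s) (fun _ => hB _) (fun w i s' => by
        have := hd (Fin.cons s w) i.succ s'
        rwa [← Fin.cons_update] at this)
      have h2 : ∀ w, Real.exp (t * (f (Fin.cons s w) - m))
          = Real.exp (t * (g s - m)) * Real.exp (t * (f (Fin.cons s w) - g s)) := by
        intro w
        rw [← Real.exp_add]; ring_nf
      simp_rw [h2]
      rw [integral_const_mul]
      gcongr
    -- The interval `[m - c, m + c]` about the mean has length 2c, so Hoeffding's lemma gives the
    -- variance proxy c²; an interval of length c would give c² / 4.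
    have hsub : HasSubgaussianMGF (fun s => g s - ∫ s, g s ∂Q)
        ((‖m + c - (m - c)‖₊ / 2) ^ 2) Q := by
      refine hasSubgaussianMGF_of_mem_Icc hgm.aemeasurable (ae_of_all _ fun s => ?_)
      have h1 : |g s - m| ≤ c := by
        have hi : Integrable g Q := by
          refine integrable_of_abs_le (B := |g s| + c) hgm fun s' => ?_
          have := abs_sub_abs_le_abs_sub (g s') (g s)
          linarith [hgB s' s]
        have e : g s - m = ∫ s', (g s - g s') ∂Q := by
          rw [integral_sub (integrable_const _) hi]; simp [hm]
        rw [e]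
        exact abs_integral_le_of_abs_le fun s' => hgB s s'
      rw [abs_le] at h1
      exact ⟨by linarith [h1.1], by linarith [h1.2]⟩
    have hmgf := hsub.mgf_le t
    have hcoe : (((‖m + c - (m - c)‖₊ / 2) ^ 2 : NNReal) : ℝ) = c ^ 2 := by
      push_cast
      rw [Real.norm_eq_abs, div_pow, sq_abs]
      ring
    rw [hcoe, mgf] at hmgf
    calc ∫ s, ∫ w, Real.exp (t * (f (Fin.cons s w) - m)) ∂π ∂Q
        ≤ ∫ s, Real.exp (t * (g s - m)) * Real.exp (n * c ^ 2 * t ^ 2 / 2) ∂Q := by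
          refine integral_mono hint.integral_prod_left ?_ hin
          exact (hsub.integrable_exp_mul t).mul_const _
      _ = (∫ s, Real.exp (t * (g s - m)) ∂Q) * Real.exp (n * c ^ 2 * t ^ 2 / 2) :=
          integral_mul_const _ _
      _ ≤ Real.exp (c ^ 2 * t ^ 2 / 2) * Real.exp (n * c ^ 2 * t ^ 2 / 2) := by gcongr
      _ = _ := by rw [← Real.exp_add]; push_cast; ring_nf

/-- **McDiarmid's inequality** (with a suboptimal constant), upper tail. -/
lemma measure_ge_le_of_bounded_differences {Ω : Type*} [MeasurableSpace Ω] {μ : Measure Ω}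
    [IsProbabilityMeasure μ] {n : ℕ} {Q : Measure S} [IsProbabilityMeasure Q]
    {W : Fin n → Ω → S} (hW : ∀ i, HasLaw (W i) Q μ) (hind : iIndepFun W μ)
    {f : (Fin n → S) → ℝ} (hf : Measurable f) {c B : ℝ} (hB : ∀ x, |f x| ≤ B)
    (hd : ∀ x i s, |f (Function.update x i s) - f x| ≤ c) {ε : ℝ} (hε : 0 ≤ ε) :
    μ.real {ω | ε ≤ f (fun i => W i ω) - ∫ ω', f (fun i => W i ω') ∂μ}
      ≤ Real.exp (-ε ^ 2 / (2 * (n * c ^ 2))) := by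
  have hlaw : μ.map (fun ω i => W i ω) = Measure.pi fun _ => Q := by
    rw [(iIndepFun_iff_map_fun_eq_pi_map fun i => (hW i).aemeasurable).1 hind]
    congr 1
    ext1 i
    exact (hW i).map_eq
  have hWm : AEMeasurable (fun ω i => W i ω) μ := aemeasurable_pi_lambda _ fun i => (hW i).aemeasurable
  have hmean : ∫ ω', f (fun i => W i ω') ∂μ = ∫ x, f x ∂(Measure.pi fun _ => Q) := by
    rw [← hlaw, integral_map hWm hf.aestronglyMeasurable]
  set m := ∫ x, f x ∂(Measure.pi fun _ : Fin n => Q)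
  have hcoe : ((n * ⟨c ^ 2, sq_nonneg c⟩ : NNReal) : ℝ) = n * c ^ 2 := rfl
  have hsub : HasSubgaussianMGF (fun x => f x - m) (n * ⟨c ^ 2, sq_nonneg c⟩)
      (Measure.pi fun _ : Fin n => Q) := by
    constructor
    · intro t
      refine integrable_of_abs_le (B := Real.exp (|t| * (B + |m|))) (by fun_prop) fun z => ?_
      rw [Real.abs_exp, Real.exp_le_exp]
      refine (le_abs_self _).trans ?_
      rw [abs_mul]
      gcongr
      exact (abs_sub _ _).trans (by gcongr; exact hB _)
    · intro t
      rw [hcoe]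
      exact integral_exp_le_of_bounded_differences Q t n f hf hB hd
  have h := hsub.measure_ge_le hε
  rw [hmean]
  have e : μ.real {ω | ε ≤ f (fun i => W i ω) - m}
      = (Measure.pi fun _ : Fin n => Q).real {x | ε ≤ f x - m} := by
    rw [← hlaw, map_measureReal_apply_of_aemeasurable hWm
      (measurableSet_le measurable_const (by fun_prop))]
    rfl
  rw [e, ← hcoe]
  exact h

lemma measure_abs_ge_le_of_bounded_differences {Ω : Type*} [MeasurableSpace Ω] {μ : Measure Ω}
    [IsProbabilityMeasure μ] {n : ℕ} {Q : Measure S} [IsProbabilityMeasure Q]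
    {W : Fin n → Ω → S} (hW : ∀ i, HasLaw (W i) Q μ) (hind : iIndepFun W μ)
    {f : (Fin n → S) → ℝ} (hf : Measurable f) {c B : ℝ} (hB : ∀ x, |f x| ≤ B)
    (hd : ∀ x i s, |f (Function.update x i s) - f x| ≤ c) {ε : ℝ} (hε : 0 ≤ ε) :
    μ.real {ω | ε ≤ |f (fun i => W i ω) - ∫ ω', f (fun i => W i ω') ∂μ|}
      ≤ 2 * Real.exp (-ε ^ 2 / (2 * (n * c ^ 2))) := by
  have h1 := measure_ge_le_of_bounded_differences hW hind hf hB hd hε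
  have h2 := measure_ge_le_of_bounded_differences hW hind (f := fun x => - f x) hf.neg (c := c)
    (B := B) (fun x => by rw [abs_neg]; exact hB x)
    (fun x i s => by rw [← abs_neg]; convert hd x i s using 2; ring) hε
  rw [integral_neg] at h2
  have hsub : {ω | ε ≤ |f (fun i => W i ω) - ∫ ω', f (fun i => W i ω') ∂μ|} ⊆
      {ω | ε ≤ f (fun i => W i ω) - ∫ ω', f (fun i => W i ω') ∂μ} ∪
      {ω | ε ≤ - f (fun i => W i ω) - -∫ ω', f (fun i => W i ω') ∂μ} := by
    intro ω hω
    rcases le_abs.1 (show ε ≤ |_| from hω) with h | h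
    · exact Or.inl h
    · refine Or.inr (show ε ≤ _ from ?_)
      linarith
  linarith [(measureReal_mono hsub).trans (measureReal_union_le (μ := μ) _ _)]

end BoundedDifferences

/-! ### Bounded V-statistics: sensitivity to one observation, and bias -/

section VStatistic

/-- Overwriting coordinate `j` by each of the `n` values is injective on `A × Fin n`, so `A` is at
most a 1/n fraction of all tuples. -/
lemma card_mul_le_of_determined {m n : ℕ} (A : Finset (Fin m → Fin n)) (j : Fin m)
    (hA : ∀ I ∈ A, ∀ I' ∈ A, (∀ k, k ≠ j → I k = I' k) → I = I') :
    (A.card : ℝ) * n ≤ (n : ℝ) ^ m := by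
  have h : (A ×ˢ (Finset.univ : Finset (Fin n))).card
      ≤ (Finset.univ : Finset (Fin m → Fin n)).card := by
    refine Finset.card_le_card_of_injOn (fun p => Function.update p.1 j p.2)
      (fun _ _ => Finset.mem_coe.2 (Finset.mem_univ _)) ?_
    rintro ⟨I, a⟩ hI ⟨I', a'⟩ hI' h
    simp only [Finset.coe_product, Set.mem_prod, Finset.mem_coe] at hI hI'
    have h1 : a = a' := by simpa using congrFun h j
    have h2 : I = I' := hA I hI.1 I' hI'.1 fun k hk => by
      have := congrFun h k
      simpa [hk] using this
    rw [h1, h2]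
  rw [Finset.card_product] at h
  have h' : A.card * n ≤ n ^ m := by simpa using h
  exact_mod_cast h'

/-- Average of a bounded family over index tuples: it changes little if the terms change on a small
set of tuples only. -/
lemma abs_average_sub_le {m n : ℕ} (hn : 1 ≤ n) {B : ℝ} {g g' : (Fin m → Fin n) → ℝ}
    (hg : ∀ I, |g I - g' I| ≤ B) (A : Finset (Fin m → Fin n)) (hA : ∀ I, I ∉ A → g I = g' I)
    {K : ℝ} (hcard : (A.card : ℝ) * n ≤ K * (n : ℝ) ^ m) :
    |((n : ℝ) ^ m)⁻¹ * ∑ I, g I - ((n : ℝ) ^ m)⁻¹ * ∑ I, g' I| ≤ K * B / n := by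
  have hn0 : (0 : ℝ) < n := by exact_mod_cast hn
  have hB : 0 ≤ B := (abs_nonneg _).trans (hg fun _ => ⟨0, hn⟩)
  rw [← mul_sub, ← Finset.sum_sub_distrib, abs_mul, abs_of_pos (by positivity : 0 < ((n : ℝ) ^ m)⁻¹)]
  have h1 : |∑ I, (g I - g' I)| ≤ A.card * B := by
    have : ∑ I, (g I - g' I) = ∑ I ∈ A, (g I - g' I) := by
      refine (Finset.sum_subset (Finset.subset_univ A) fun I _ hI => ?_).symm
      rw [hA I hI, sub_self]
    rw [this]
    refine (Finset.abs_sum_le_sum_abs _ _).trans ?_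
    refine (Finset.sum_le_card_nsmul _ _ B fun I _ => hg I).trans ?_
    rw [nsmul_eq_mul]
  rw [le_div_iff₀ hn0, inv_mul_eq_div, div_mul_eq_mul_div, div_le_iff₀ (by positivity)]
  calc |∑ I, (g I - g' I)| * n ≤ A.card * B * n := by gcongr
    _ = A.card * n * B := by ring
    _ ≤ K * (n : ℝ) ^ m * B := by gcongr
    _ = K * B * (n : ℝ) ^ m := by ring

variable {S : Type*}

/-- The average of `T I z` over all index tuples `I`. -/
def vStat {m n : ℕ} (T : (Fin m → Fin n) → (Fin n → S) → ℝ) (z : Fin n → S) : ℝ :=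
  ((n : ℝ) ^ m)⁻¹ * ∑ I, T I z

lemma abs_vStat_le {m n : ℕ} (hn : 1 ≤ n) {T : (Fin m → Fin n) → (Fin n → S) → ℝ} {B : ℝ}
    (hT : ∀ I z, |T I z| ≤ B) (z : Fin n → S) : |vStat T z| ≤ B := by
  have hn0 : (0 : ℝ) < n := by exact_mod_cast hn
  unfold vStat
  rw [abs_mul, abs_of_pos (by positivity : 0 < ((n : ℝ) ^ m)⁻¹), inv_mul_le_iff₀ (by positivity)]
  refine (Finset.abs_sum_le_sum_abs _ _).trans ?_
  refine (Finset.sum_le_card_nsmul _ _ B fun I _ => hT I z).trans ?_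
  simp

/-- Only tuples that hit `i` are affected: a 1/n fraction for each of the `m` positions, each term
moving by at most 2B. -/
lemma abs_vStat_update_sub_le {m n : ℕ} (hn : 1 ≤ n) {T : (Fin m → Fin n) → (Fin n → S) → ℝ} {B : ℝ}
    (hT : ∀ I z, |T I z| ≤ B) (hdep : ∀ I z z', (∀ j, z (I j) = z' (I j)) → T I z = T I z')
    (z : Fin n → S) (i : Fin n) (s : S) :
    |vStat T (Function.update z i s) - vStat T z| ≤ m * (2 * B) / n := by
  classical
  refine abs_average_sub_le hn (fun I => ?_)
    (Finset.univ.biUnion fun j : Fin m => Finset.univ.filter fun I => I j = i) (fun I hI => ?_) ?_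
  · refine (abs_sub _ _).trans ?_
    linarith [hT I (Function.update z i s), hT I z]
  · refine hdep I _ _ fun j => ?_
    have : I j ≠ i := fun h => hI (by simpa using ⟨j, h⟩)
    simp [this]
  · have h1 : ∀ j : Fin m, ((Finset.univ.filter fun I : Fin m → Fin n => I j = i).card : ℝ) * n
        ≤ (n : ℝ) ^ m := fun j => card_mul_le_of_determined _ j fun I hI I' hI' h => by
      ext1 k
      by_cases hk : k = j
      · rw [hk, (Finset.mem_filter.1 hI).2, (Finset.mem_filter.1 hI').2]
      · exact h k hk
    calc _ ≤ (∑ j : Fin m, ((Finset.univ.filter fun I : Fin m → Fin n => I j = i).card : ℝ)) * n := by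
          gcongr
          exact_mod_cast Finset.card_biUnion_le
      _ ≤ _ := by
          rw [Finset.sum_mul]
          refine (Finset.sum_le_sum fun j _ => h1 j).trans ?_
          simp

/-- A V-statistic is almost unbiased. -/
lemma abs_integral_vStat_sub_le {Ω : Type*} [MeasurableSpace Ω] {μ : Measure Ω}
    [IsProbabilityMeasure μ] {m n : ℕ} (hn : 1 ≤ n) {T : (Fin m → Fin n) → (Fin n → S) → ℝ} {B : ℝ}
    (hT : ∀ I z, |T I z| ≤ B) {W : Fin n → Ω → S}
    (hint : ∀ I, Integrable (fun ω => T I (fun i => W i ω)) μ) {θ : ℝ} (hθ : |θ| ≤ B)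
    (hE : ∀ I, Function.Injective I → ∫ ω, T I (fun i => W i ω) ∂μ = θ) :
    |∫ ω, vStat T (fun i => W i ω) ∂μ - θ| ≤ m ^ 2 * (2 * B) / n := by
  classical
  have hn0 : (0 : ℝ) < n := by exact_mod_cast hn
  have e1 : ∫ ω, vStat T (fun i => W i ω) ∂μ
      = ((n : ℝ) ^ m)⁻¹ * ∑ I, ∫ ω, T I (fun i => W i ω) ∂μ := by
    unfold vStat
    rw [integral_const_mul, integral_finsetSum _ fun I _ => hint I]
  have e2 : θ = ((n : ℝ) ^ m)⁻¹ * ∑ _I : Fin m → Fin n, θ := by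
    simp; field_simp
  rw [e1]
  conv_lhs => rw [e2]
  -- The exceptional tuples have a repeated index: for each of at most m² pairs of positions, a 1/n
  -- fraction.
  refine abs_average_sub_le hn (fun I => ?_)
    (Finset.univ.biUnion fun p : Fin m × Fin m =>
      Finset.univ.filter fun I => p.1 ≠ p.2 ∧ I p.1 = I p.2) (fun I hI => ?_) ?_
  · refine (abs_sub _ _).trans ?_
    linarith [abs_integral_le_of_abs_le (μ := μ) fun ω => hT I (fun i => W i ω)]
  · refine hE I fun j k hjk => ?_
    by_contra hne
    exact hI (by simpa using ⟨j, k, hne, hjk⟩)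
  · have h1 : ∀ p : Fin m × Fin m, ((Finset.univ.filter fun I : Fin m → Fin n =>
        p.1 ≠ p.2 ∧ I p.1 = I p.2).card : ℝ) * n ≤ (n : ℝ) ^ m := fun p =>
      card_mul_le_of_determined _ p.1 fun I hI I' hI' h => by
        ext1 k
        by_cases hk : k = p.1
        · rw [hk, (Finset.mem_filter.1 hI).2.2, (Finset.mem_filter.1 hI').2.2]
          exact h _ (Finset.mem_filter.1 hI).2.1.symm
        · exact h k hk
    calc _ ≤ (∑ p : Fin m × Fin m, ((Finset.univ.filter fun I : Fin m → Fin n =>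
            p.1 ≠ p.2 ∧ I p.1 = I p.2).card : ℝ)) * n := by
          gcongr
          exact_mod_cast Finset.card_biUnion_le
      _ ≤ _ := by
          rw [Finset.sum_mul]
          refine (Finset.sum_le_sum fun j _ => h1 j).trans ?_
          simp [sq]

end VStatistic

/-! ### The sample projection covariance as a V-statistic -/

/-- The supplementary angle `π - a_{klr}`. -/
def coAngle {n d : ℕ} (x : Fin n → Euc d) (k l r : Fin n) : ℝ := Real.pi - angleArr x k l r

lemma abs_coAngle_le {n d : ℕ} (x : Fin n → Euc d) (k l r : Fin n) : |coAngle x k l r| ≤ Real.pi := by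
  unfold coAngle angleArr
  have := Real.pi_pos
  split_ifs
  · rw [sub_zero, abs_of_pos this]
  · rw [abs_of_nonneg (sub_nonneg.2 (Real.arccos_le_pi _))]
    linarith [Real.arccos_nonneg (inner ℝ (x k - x r) (x l - x r) / (‖x k - x r‖ * ‖x l - x r‖))]

/-- The kernel of the sample projection covariance; the index tuple is `(r, k, l, k', l')`. -/
def pcovKernel {n d e : ℕ} (I : Fin 5 → Fin n) (z : Fin n → Euc d × Euc e) : ℝ :=
  coAngle (fun i => (z i).1) (I 1) (I 2) (I 0) *
    (coAngle (fun i => (z i).2) (I 1) (I 2) (I 0) - coAngle (fun i => (z i).2) (I 1) (I 4) (I 0)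
      - coAngle (fun i => (z i).2) (I 3) (I 2) (I 0) + coAngle (fun i => (z i).2) (I 3) (I 4) (I 0))

lemma sum_fin_succ_fun {n m : ℕ} (F : (Fin (m + 1) → Fin n) → ℝ) :
    ∑ I, F I = ∑ a, ∑ J : Fin m → Fin n, F (Fin.cons a J) := by
  rw [← Fintype.sum_prod_type']
  exact (Fintype.sum_equiv (Fin.consEquiv fun _ => Fin n) _ _ fun _ => rfl).symm

lemma sum_fin_five {n : ℕ} (F : Fin n → Fin n → Fin n → Fin n → Fin n → ℝ) :
    ∑ I : Fin 5 → Fin n, F (I 0) (I 1) (I 2) (I 3) (I 4)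
      = ∑ r, ∑ k, ∑ l, ∑ k', ∑ l', F r k l k' l' := by
  simp only [sum_fin_succ_fun, Finset.univ_unique, Finset.sum_singleton]
  rfl

/-- The doubly centred version of a square array. -/
def doubleCentre {n : ℕ} (a : Fin n → Fin n → ℝ) (k l : Fin n) : ℝ :=
  a k l - (n : ℝ)⁻¹ * ∑ l', a k l' - (n : ℝ)⁻¹ * ∑ k', a k' l
    + ((n : ℝ) ^ 2)⁻¹ * ∑ k', ∑ l', a k' l'

lemma sum_doubleCentre_right {n : ℕ} (hn : 1 ≤ n) (a : Fin n → Fin n → ℝ) (k : Fin n) :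
    ∑ l, doubleCentre a k l = 0 := by
  have hn0 : (n : ℝ) ≠ 0 := by positivity
  unfold doubleCentre
  rw [Finset.sum_comm (f := fun k' l' => a k' l')]
  simp only [Finset.sum_add_distrib, Finset.sum_sub_distrib, ← Finset.mul_sum,
    Finset.sum_const, Finset.card_univ, Fintype.card_fin, nsmul_eq_mul]
  field_simp
  ring

lemma sum_doubleCentre_left {n : ℕ} (hn : 1 ≤ n) (a : Fin n → Fin n → ℝ) (l : Fin n) :
    ∑ k, doubleCentre a k l = 0 := by
  have hn0 : (n : ℝ) ≠ 0 := by positivity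
  unfold doubleCentre
  rw [Finset.sum_add_distrib, Finset.sum_sub_distrib, Finset.sum_sub_distrib, ← Finset.mul_sum]
  simp only [Finset.sum_const, Finset.card_univ, Fintype.card_fin, nsmul_eq_mul]
  field_simp
  ring

/-- Centring is an orthogonal projection, so it need only be applied to one factor; on that factor
it is an average over two fresh indices `k'`, `l'`. -/
lemma sum_doubleCentre_mul {n : ℕ} (hn : 1 ≤ n) (a b : Fin n → Fin n → ℝ) :
    ∑ k, ∑ l, doubleCentre a k l * doubleCentre b k l
      = ((n : ℝ) ^ 2)⁻¹ * ∑ k, ∑ l, ∑ k', ∑ l', a k l * (b k l - b k l' - b k' l + b k' l') := by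
  have hn0 : (n : ℝ) ≠ 0 := by positivity
  have h1 : ∀ k l, ∑ k', ∑ l', a k l * (b k l - b k l' - b k' l + b k' l')
      = (n : ℝ) ^ 2 * (a k l * doubleCentre b k l) := by
    intro k l
    simp only [← Finset.mul_sum]
    unfold doubleCentre
    simp only [Finset.sum_add_distrib, Finset.sum_sub_distrib, Finset.sum_const, Finset.card_univ,
      Fintype.card_fin, nsmul_eq_mul, ← Finset.mul_sum]
    field_simp
  simp only [h1]
  simp only [← Finset.mul_sum]
  rw [inv_mul_cancel_left₀ (by positivity)]
  -- The corrections to `a` depend on at most one of `k`, `l`, and are annihilated by the vanishing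
  -- row and column sums of the centred `b`.
  have h2 : ∀ k l, doubleCentre a k l * doubleCentre b k l = a k l * doubleCentre b k l
      - ((n : ℝ)⁻¹ * ∑ l', a k l') * doubleCentre b k l
      - ((n : ℝ)⁻¹ * ∑ k', a k' l) * doubleCentre b k l
      + (((n : ℝ) ^ 2)⁻¹ * ∑ k', ∑ l', a k' l') * doubleCentre b k l := by
    intro k l
    conv_lhs => enter [1]; unfold doubleCentre
    ring
  simp only [h2, Finset.sum_add_distrib, Finset.sum_sub_distrib]
  rw [Finset.sum_comm (f := fun k l => ((n : ℝ)⁻¹ * ∑ k', a k' l) * doubleCentre b k l)]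
  simp only [← Finset.mul_sum, sum_doubleCentre_right hn, sum_doubleCentre_left hn, mul_zero,
    Finset.sum_const_zero, sub_zero, add_zero]

/-- Double centring kills the constant π. The remaining sign disappears in products of two centred
arrays. -/
lemma centredArr_eq {n d : ℕ} (hn : 1 ≤ n) (x : Fin n → Euc d) (k l r : Fin n) :
    centredArr x k l r = - doubleCentre (fun k l => coAngle x k l r) k l := by
  have hn0 : (n : ℝ) ≠ 0 := by positivity
  unfold centredArr doubleCentre coAngle
  simp only [Finset.sum_sub_distrib, Finset.sum_const, Finset.card_univ, Fintype.card_fin,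
    nsmul_eq_mul]
  field_simp
  ring

/-- The indices `k`, `l`, `r` together with the two averaging indices make a tuple of five; n⁻³ ·
n⁻² is the normalisation of a V-statistic of that order. -/
lemma samplePcovSq_eq_vStat {n d e : ℕ} (hn : 1 ≤ n) (z : Fin n → Euc d × Euc e) :
    samplePcovSq (fun i => (z i).1) (fun i => (z i).2) = vStat pcovKernel z := by
  have hn0 : (n : ℝ) ≠ 0 := by positivity
  unfold samplePcovSq vStat pcovKernel
  rw [sum_fin_five fun r k l k' l' => coAngle (fun i => (z i).1) k l r *
    (coAngle (fun i => (z i).2) k l r - coAngle (fun i => (z i).2) k l' r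
      - coAngle (fun i => (z i).2) k' l r + coAngle (fun i => (z i).2) k' l' r)]
  have h1 : ∑ k, ∑ l, ∑ r, centredArr (fun i => (z i).1) k l r * centredArr (fun i => (z i).2) k l r
      = ∑ r, ∑ k, ∑ l, centredArr (fun i => (z i).1) k l r * centredArr (fun i => (z i).2) k l r := by
    rw [Finset.sum_comm]
    conv_lhs => enter [2, l]; rw [Finset.sum_comm]
    rw [Finset.sum_comm]
    exact Finset.sum_congr rfl fun r _ => Finset.sum_comm
  rw [h1]
  simp only [centredArr_eq hn, neg_mul_neg]
  rw [Finset.sum_congr rfl fun r _ => sum_doubleCentre_mul hn (fun k l => coAngle (fun i => (z i).1)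
    k l r) (fun k l => coAngle (fun i => (z i).2) k l r), ← Finset.mul_sum, ← mul_assoc, ← mul_inv,
    ← pow_add]

lemma abs_pcovKernel_le {n d e : ℕ} (I : Fin 5 → Fin n) (z : Fin n → Euc d × Euc e) :
    |pcovKernel I z| ≤ 4 * Real.pi ^ 2 := by
  unfold pcovKernel
  have h := fun k l r => abs_le.1 (abs_coAngle_le (fun i => (z i).2) k l r)
  rw [abs_mul]
  have : 4 * Real.pi ^ 2 = Real.pi * (4 * Real.pi) := by ring
  rw [this]
  refine mul_le_mul (abs_coAngle_le _ _ _ _) ?_ (abs_nonneg _) Real.pi_pos.le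
  have h1 := h (I 1) (I 2) (I 0)
  have h2 := h (I 1) (I 4) (I 0)
  have h3 := h (I 3) (I 2) (I 0)
  have h4 := h (I 3) (I 4) (I 0)
  rw [abs_le]
  constructor <;> linarith [h1.1, h1.2, h2.1, h2.2, h3.1, h3.2, h4.1, h4.2]

lemma pcovKernel_congr {n d e : ℕ} (I : Fin 5 → Fin n) (z z' : Fin n → Euc d × Euc e)
    (h : ∀ j, z (I j) = z' (I j)) : pcovKernel I z = pcovKernel I z' := by
  unfold pcovKernel coAngle angleArr
  simp only [h]

lemma measurable_coAngle {n d : ℕ} (k l r : Fin n) :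
    Measurable fun x : Fin n → Euc d => coAngle x k l r := by
  unfold coAngle angleArr
  refine measurable_const.sub ?_
  split_ifs
  · exact measurable_const
  · exact Real.continuous_arccos.measurable.comp (by fun_prop)

lemma measurable_pcovKernel {n d e : ℕ} (I : Fin 5 → Fin n) :
    Measurable fun z : Fin n → Euc d × Euc e => pcovKernel I z := by
  unfold pcovKernel
  have h1 : Measurable fun z : Fin n → Euc d × Euc e => fun i => (z i).1 := by fun_prop
  have h2 : Measurable fun z : Fin n → Euc d × Euc e => fun i => (z i).2 := by fun_prop
  have h3 := fun k l r => (measurable_coAngle (d := d) (n := n) k l r).comp h1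
  have h4 := fun k l r => (measurable_coAngle (d := e) (n := n) k l r).comp h2
  exact (h3 _ _ _).mul ((((h4 _ _ _).sub (h4 _ _ _)).sub (h4 _ _ _)).add (h4 _ _ _))

/-! ### The population covariance as the mean of the angle kernel -/

lemma integral_swap_pairs {A B C D : Type*} [MeasurableSpace A] [MeasurableSpace B]
    [MeasurableSpace C] [MeasurableSpace D] {μa : Measure A} {μb : Measure B} {μc : Measure C}
    {μd : Measure D} [IsFiniteMeasure μa] [IsFiniteMeasure μb] [IsFiniteMeasure μc]
    [IsFiniteMeasure μd] {F : (A × B) × (C × D) → ℝ} (hF : Measurable F) {K : ℝ}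
    (hK : ∀ x, |F x| ≤ K) :
    ∫ a, ∫ b, ∫ c, ∫ d, F ((a, b), (c, d)) ∂μd ∂μc ∂μb ∂μa
      = ∫ c, ∫ d, ∫ a, ∫ b, F ((a, b), (c, d)) ∂μb ∂μa ∂μd ∂μc := by
  have hint : Integrable F ((μa.prod μb).prod (μc.prod μd)) := integrable_of_abs_le hF hK
  have h1 : ∀ ab : A × B, ∫ c, ∫ d, F (ab, (c, d)) ∂μd ∂μc = ∫ cd, F (ab, cd) ∂(μc.prod μd) :=
    fun ab => (integral_prod (fun cd => F (ab, cd)) (integrable_of_abs_le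
      (hF.comp measurable_prodMk_left) fun _ => hK _)).symm
  have h2 : ∀ cd : C × D, ∫ a, ∫ b, F ((a, b), cd) ∂μb ∂μa = ∫ ab, F (ab, cd) ∂(μa.prod μb) :=
    fun cd => (integral_prod (fun ab => F (ab, cd)) (integrable_of_abs_le
      (hF.comp measurable_prodMk_right) fun _ => hK _)).symm
  simp only [h1, h2]
  rw [← integral_prod (fun ab => ∫ cd, F (ab, cd) ∂(μc.prod μd)) hint.integral_prod_left,
    ← integral_prod (fun cd => ∫ ab, F (ab, cd) ∂(μa.prod μb)) hint.integral_prod_right]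
  exact integral_integral_swap hint

lemma integral_sub_sub_add {X : Type*} [MeasurableSpace X] {μ : Measure X} {f g h k : X → ℝ}
    (hf : Integrable f μ) (hg : Integrable g μ) (hh : Integrable h μ) (hk : Integrable k μ) :
    ∫ x, (f x - g x - h x + k x) ∂μ = ∫ x, f x ∂μ - ∫ x, g x ∂μ - ∫ x, h x ∂μ + ∫ x, k x ∂μ := by
  rw [← integral_sub' hf hg, ← integral_sub' (hf.sub hg) hh, ← integral_add' ((hf.sub hg).sub hh) hk]
  rfl

lemma measurableSet_and {X : Type*} [MeasurableSpace X] {p r : X → Prop}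
    (hp : MeasurableSet {x | p x}) (hr : MeasurableSet {x | r x}) :
    MeasurableSet {x | p x ∧ r x} := hp.inter hr

/-- The indicator that `w` precedes `z` in the direction `α`. -/
def below {d : ℕ} (α z w : Euc d) : ℝ := if inner ℝ α (w - z) ≤ 0 then 1 else 0

lemma below_nonneg {d : ℕ} (α z w : Euc d) : 0 ≤ below α z w := by
  unfold below; split_ifs <;> norm_num

lemma below_le_one {d : ℕ} (α z w : Euc d) : below α z w ≤ 1 := by
  unfold below; split_ifs <;> norm_num

lemma measurable_below {d : ℕ} {X : Type*} [MeasurableSpace X] {a z w : X → Euc d}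
    (ha : Measurable a) (hz : Measurable z) (hw : Measurable w) :
    Measurable fun x => below (a x) (z x) (w x) := by
  unfold below
  exact Measurable.ite (measurableSet_le (by fun_prop) measurable_const) measurable_const
    measurable_const

/-- `F_{U,V}(u,v) - F_U(u) F_V(v)` at the projections of `z`. -/
def covAt {d e : ℕ} (P : Measure (Euc d × Euc e)) (α : Euc d) (β : Euc e) (z : Euc d × Euc e) : ℝ :=
  ∫ w, below α z.1 w.1 * below β z.2 w.2 ∂P - (∫ w, below α z.1 w.1 ∂P) * ∫ w, below β z.2 w.2 ∂P

lemma pcovSq_eq_integral_covAt {d e : ℕ} (P : Measure (Euc d × Euc e)) [IsProbabilityMeasure P] :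
    pcovSq P = ∫ α, ∫ β, ∫ z, covAt P (α : Euc d) (β : Euc e) z ^ 2 ∂P ∂(surface e)
      ∂(surface d) := by
  unfold pcovSq
  refine integral_congr_ae (ae_of_all _ fun α => integral_congr_ae (ae_of_all _ fun β => ?_))
  simp only
  have hφ : Measurable fun z : Euc d × Euc e =>
    ((inner ℝ (α : Euc d) z.1 : ℝ), (inner ℝ (β : Euc e) z.2 : ℝ)) := by fun_prop
  have : IsProbabilityMeasure (projLaw P (α : Euc d) (β : Euc e)) :=
    Measure.isProbabilityMeasure_map hφ.aemeasurable
  have hind : ∀ {s : Set (Euc d × Euc e)} [DecidablePred (· ∈ s)], MeasurableSet s →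
      P.real s = ∫ w, (if w ∈ s then (1 : ℝ) else 0) ∂P := by
    intro s _ hs
    rw [← integral_indicator_one hs]
    refine integral_congr_ae (ae_of_all _ fun w => ?_)
    simp [Set.indicator_apply]
  rw [projLaw, integral_map hφ.aemeasurable]
  · refine integral_congr_ae (ae_of_all _ fun z => ?_)
    simp only
    unfold covAt
    have m1 : MeasurableSet {w : Euc d × Euc e | inner ℝ (α : Euc d) w.1 ≤ inner ℝ (α : Euc d) z.1} :=
      measurableSet_le (by fun_prop) measurable_const
    have m2 : MeasurableSet {w : Euc d × Euc e | inner ℝ (β : Euc e) w.2 ≤ inner ℝ (β : Euc e) z.2} :=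
      measurableSet_le (by fun_prop) measurable_const
    classical
    have e1 : (P.map fun z : Euc d × Euc e =>
        ((inner ℝ (α : Euc d) z.1 : ℝ), (inner ℝ (β : Euc e) z.2 : ℝ))).real
        (Set.Iic (inner ℝ (α : Euc d) z.1) ×ˢ Set.Iic (inner ℝ (β : Euc e) z.2))
        = ∫ w, below (α : Euc d) z.1 w.1 * below (β : Euc e) z.2 w.2 ∂P := by
      rw [map_measureReal_apply hφ (measurableSet_Iic.prod measurableSet_Iic)]
      refine (hind (m1.inter m2)).trans (integral_congr_ae (ae_of_all _ fun w => ?_))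
      simp only [below, inner_sub_right, sub_nonpos, Set.mem_inter_iff, Set.mem_ofPred_eq]
      split_ifs <;> simp_all
    have e2 : (P.map fun z : Euc d × Euc e =>
        ((inner ℝ (α : Euc d) z.1 : ℝ), (inner ℝ (β : Euc e) z.2 : ℝ))).fst.real
        (Set.Iic (inner ℝ (α : Euc d) z.1)) = ∫ w, below (α : Euc d) z.1 w.1 ∂P := by
      rw [Measure.fst, map_measureReal_apply measurable_fst measurableSet_Iic,
        map_measureReal_apply hφ (measurable_fst measurableSet_Iic)]
      refine (hind m1).trans (integral_congr_ae (ae_of_all _ fun w => ?_))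
      simp only [below, inner_sub_right, sub_nonpos]
      simp
    have e3 : (P.map fun z : Euc d × Euc e =>
        ((inner ℝ (α : Euc d) z.1 : ℝ), (inner ℝ (β : Euc e) z.2 : ℝ))).snd.real
        (Set.Iic (inner ℝ (β : Euc e) z.2)) = ∫ w, below (β : Euc e) z.2 w.2 ∂P := by
      rw [Measure.snd, map_measureReal_apply measurable_snd measurableSet_Iic,
        map_measureReal_apply hφ (measurable_snd measurableSet_Iic)]
      refine (hind m2).trans (integral_congr_ae (ae_of_all _ fun w => ?_))
      simp only [below, inner_sub_right, sub_nonpos]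
      simp
    rw [e1, e2, e3]
  · refine Measurable.aestronglyMeasurable (Measurable.pow_const ?_ 2)
    set R := P.map fun z : Euc d × Euc e =>
        ((inner ℝ (α : Euc d) z.1 : ℝ), (inner ℝ (β : Euc e) z.2 : ℝ))
    have : IsProbabilityMeasure R := Measure.isProbabilityMeasure_map hφ.aemeasurable
    have hm : Measurable fun uv : ℝ × ℝ => R (Set.Iic uv.1 ×ˢ Set.Iic uv.2) := by
      have hs : MeasurableSet {x : (ℝ × ℝ) × (ℝ × ℝ) | x.2.1 ≤ x.1.1 ∧ x.2.2 ≤ x.1.2} :=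
        measurableSet_and (measurableSet_le (by fun_prop) (by fun_prop))
          (measurableSet_le (by fun_prop) (by fun_prop))
      exact measurable_measure_prodMk_left hs
    have hm1 : Measurable fun uv : ℝ × ℝ => R.fst (Set.Iic uv.1) :=
      (measurable_measure_prodMk_left (ν := R.fst) (s := {x : ℝ × ℝ | x.2 ≤ x.1})
        (measurableSet_le (by fun_prop) (by fun_prop))).comp measurable_fst
    have hm2 : Measurable fun uv : ℝ × ℝ => R.snd (Set.Iic uv.2) :=
      (measurable_measure_prodMk_left (ν := R.snd) (s := {x : ℝ × ℝ | x.2 ≤ x.1})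
        (measurableSet_le (by fun_prop) (by fun_prop))).comp measurable_snd
    exact hm.ennreal_toReal.sub (hm1.ennreal_toReal.mul hm2.ennreal_toReal)

/-- The integrand of the squared projection covariance over four independent copies. -/
def covKernel {d e : ℕ} (α : Euc d) (β : Euc e) (z : Euc d × Euc e) (w : Fin 4 → Euc d × Euc e) : ℝ :=
  below α z.1 (w 0).1 * below α z.1 (w 1).1 *
    (below β z.2 (w 0).2 * below β z.2 (w 1).2 - below β z.2 (w 0).2 * below β z.2 (w 3).2
      - below β z.2 (w 2).2 * below β z.2 (w 1).2 + below β z.2 (w 2).2 * below β z.2 (w 3).2)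

lemma integral_prod_four {S : Type*} [MeasurableSpace S] (P : Measure S) [IsProbabilityMeasure P]
    (f0 f1 f2 f3 : S → ℝ) :
    ∫ w : Fin 4 → S, f0 (w 0) * f1 (w 1) * f2 (w 2) * f3 (w 3) ∂(Measure.pi fun _ => P)
      = (∫ s, f0 s ∂P) * (∫ s, f1 s ∂P) * (∫ s, f2 s ∂P) * ∫ s, f3 s ∂P := by
  have h := integral_fintype_prod_eq_prod (𝕜 := ℝ) (μ := fun _ : Fin 4 => P) ![f0, f1, f2, f3]
  simpa [Fin.prod_univ_four] using h

lemma abs_below_mul_le {d e : ℕ} (α z w z' w' : Euc d) (β y v y' v' : Euc e) :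
    |below α z w * below α z' w' * (below β y v * below β y' v')| ≤ 1 := by
  have h1 := below_nonneg α z w
  have h2 := below_nonneg α z' w'
  have h3 := below_nonneg β y v
  have h4 := below_nonneg β y' v'
  rw [abs_of_nonneg (by positivity)]
  exact mul_le_one₀ (mul_le_one₀ (below_le_one _ _ _) h2 (below_le_one _ _ _)) (by positivity)
    (mul_le_one₀ (below_le_one _ _ _) h4 (below_le_one _ _ _))

/-- With A, B the two indicators, the kernel is A₀(B₀ - B₂) · A₁(B₁ - B₃). The factors use disjoint
pairs of independent copies, and each has mean E[AB] - E[A] E[B]. In expanded form every term is two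
α-indicators times two β-indicators, which is what the integration over directions needs. -/
lemma covAt_sq {d e : ℕ} (P : Measure (Euc d × Euc e)) [IsProbabilityMeasure P] (α : Euc d)
    (β : Euc e) (z : Euc d × Euc e) :
    covAt P α β z ^ 2 = ∫ w, covKernel α β z w ∂(Measure.pi fun _ : Fin 4 => P) := by
  have hm : ∀ i : Fin 4, Measurable fun w : Fin 4 → Euc d × Euc e => below α z.1 (w i).1 := fun i =>
    measurable_below measurable_const measurable_const (by fun_prop)
  have hm' : ∀ i : Fin 4, Measurable fun w : Fin 4 → Euc d × Euc e => below β z.2 (w i).2 := fun i =>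
    measurable_below measurable_const measurable_const (by fun_prop)
  have hi : ∀ i j : Fin 4, Integrable (fun w : Fin 4 → Euc d × Euc e =>
      below α z.1 (w 0).1 * below α z.1 (w 1).1 * (below β z.2 (w i).2 * below β z.2 (w j).2))
      (Measure.pi fun _ : Fin 4 => P) := fun i j =>
    integrable_of_abs_le (((hm 0).mul (hm 1)).mul ((hm' i).mul (hm' j)))
      fun w => abs_below_mul_le _ _ _ _ _ _ _ _ _ _
  unfold covKernel covAt
  simp only [mul_add, mul_sub]
  rw [integral_sub_sub_add (hi 0 1) (hi 0 3) (hi 2 1) (hi 2 3)]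
  have h1 := integral_prod_four P (fun s => below α z.1 s.1 * below β z.2 s.2)
    (fun s => below α z.1 s.1 * below β z.2 s.2) (fun _ => 1) (fun _ => 1)
  have h2 := integral_prod_four P (fun s => below α z.1 s.1 * below β z.2 s.2)
    (fun s => below α z.1 s.1) (fun _ => 1) (fun s => below β z.2 s.2)
  have h3 := integral_prod_four P (fun s => below α z.1 s.1)
    (fun s => below α z.1 s.1 * below β z.2 s.2) (fun s => below β z.2 s.2) (fun _ => 1)
  have h4 := integral_prod_four P (fun s => below α z.1 s.1) (fun s => below α z.1 s.1)
    (fun s => below β z.2 s.2) (fun s => below β z.2 s.2)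
  simp only [integral_const, probReal_univ, smul_eq_mul, mul_one] at h1 h2 h3 h4
  rw [show (∫ w : Fin 4 → Euc d × Euc e, below α z.1 (w 0).1 * below α z.1 (w 1).1 *
      (below β z.2 (w 0).2 * below β z.2 (w 1).2) ∂(Measure.pi fun _ => P)) = _ from
      (integral_congr_ae (ae_of_all _ fun w => by ring)).trans h1,
    show (∫ w : Fin 4 → Euc d × Euc e, below α z.1 (w 0).1 * below α z.1 (w 1).1 *
      (below β z.2 (w 0).2 * below β z.2 (w 3).2) ∂(Measure.pi fun _ => P)) = _ from
      (integral_congr_ae (ae_of_all _ fun w => by ring)).trans h2,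
    show (∫ w : Fin 4 → Euc d × Euc e, below α z.1 (w 0).1 * below α z.1 (w 1).1 *
      (below β z.2 (w 2).2 * below β z.2 (w 1).2) ∂(Measure.pi fun _ => P)) = _ from
      (integral_congr_ae (ae_of_all _ fun w => by ring)).trans h3,
    show (∫ w : Fin 4 → Euc d × Euc e, below α z.1 (w 0).1 * below α z.1 (w 1).1 *
      (below β z.2 (w 2).2 * below β z.2 (w 3).2) ∂(Measure.pi fun _ => P)) = _ from
      (integral_congr_ae (ae_of_all _ fun w => by ring)).trans h4]
  ring

/-- The constant `|S^{d-1}| / (2π)` that relates solid angles to plane angles. -/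
def sphereConst (d : ℕ) : ℝ := sigma (fun _ : Euc d => True) / (2 * Real.pi)

lemma integral_below_mul_below {d : ℕ} {z w w' : Euc d} (hw : w ≠ z) (hw' : w' ≠ z) :
    ∫ α, below (α : Euc d) z w * below (α : Euc d) z w' ∂(surface d)
      = sphereConst d * (Real.pi - InnerProductGeometry.angle (w - z) (w' - z)) := by
  rw [sphereConst, ← sigma_inner_le_and_le (sub_ne_zero.2 hw) (sub_ne_zero.2 hw')]
  have hs : MeasurableSet {α : Metric.sphere (0 : Euc d) 1 | inner ℝ (α : Euc d) (w - z) ≤ 0 ∧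
      inner ℝ (α : Euc d) (w' - z) ≤ 0} :=
    measurableSet_and (measurableSet_le (by fun_prop) measurable_const)
      (measurableSet_le (by fun_prop) measurable_const)
  unfold sigma
  rw [← integral_indicator_one hs]
  refine integral_congr_ae (ae_of_all _ fun α => ?_)
  simp only [below, Set.indicator_apply, Set.mem_ofPred_eq, Pi.one_apply]
  split_ifs <;> simp_all

/-- Absence of atoms of both marginals of a joint law. -/
def NoAtomMarginals {d e : ℕ} (P : Measure (Euc d × Euc e)) : Prop :=
  (∀ v, P.fst {v} = 0) ∧ ∀ v, P.snd {v} = 0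

lemma coAngle_eq {n d : ℕ} {x : Fin n → Euc d} {k l r : Fin n} (hk : k ≠ r) (hl : l ≠ r) :
    coAngle x k l r = Real.pi - InnerProductGeometry.angle (x k - x r) (x l - x r) := by
  simp [coAngle, angleArr, hk, hl, InnerProductGeometry.angle]

/-- Once the directions are integrated first, every product of two indicators turns into a
supplementary angle, and the expanded covariance kernel becomes `pcovKernel` with vertex `z` and the
four copies as the other indices. -/
lemma pcovSq_eq {d e : ℕ} (P : Measure (Euc d × Euc e)) [IsProbabilityMeasure P]
    (hP : NoAtomMarginals P) :
    pcovSq P = sphereConst d * sphereConst e *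
      ∫ w, pcovKernel id w ∂(Measure.pi fun _ : Fin 5 => P) := by
  have hmeas : Measurable fun x : (Metric.sphere (0 : Euc d) 1 × Metric.sphere (0 : Euc e) 1) ×
      ((Euc d × Euc e) × (Fin 4 → Euc d × Euc e)) => covKernel (x.1.1 : Euc d) (x.1.2 : Euc e)
        x.2.1 x.2.2 := by
    have h1 : ∀ i : Fin 4, Measurable fun x : (Metric.sphere (0 : Euc d) 1 ×
        Metric.sphere (0 : Euc e) 1) × ((Euc d × Euc e) × (Fin 4 → Euc d × Euc e)) =>
        below (x.1.1 : Euc d) x.2.1.1 (x.2.2 i).1 := fun i =>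
      measurable_below (by fun_prop) (by fun_prop) (by fun_prop)
    have h2 : ∀ i : Fin 4, Measurable fun x : (Metric.sphere (0 : Euc d) 1 ×
        Metric.sphere (0 : Euc e) 1) × ((Euc d × Euc e) × (Fin 4 → Euc d × Euc e)) =>
        below (x.1.2 : Euc e) x.2.1.2 (x.2.2 i).2 := fun i =>
      measurable_below (by fun_prop) (by fun_prop) (by fun_prop)
    exact ((h1 0).mul (h1 1)).mul (((((h2 0).mul (h2 1)).sub ((h2 0).mul (h2 3))).sub
      ((h2 2).mul (h2 1))).add ((h2 2).mul (h2 3)))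
  have hbd : ∀ (α : Euc d) (β : Euc e) z w, |covKernel α β z w| ≤ 4 := by
    intro α β z w
    unfold covKernel
    have h := fun i j : Fin 4 => abs_le.1 (abs_below_mul_le α z.1 (w 0).1 z.1 (w 1).1 β z.2 (w i).2
      z.2 (w j).2)
    rw [mul_add, mul_sub, mul_sub, abs_le]
    constructor <;> linarith [h 0 1, h 0 3, h 2 1, h 2 3]
  rw [pcovSq_eq_integral_covAt]
  simp only [covAt_sq]
  rw [integral_swap_pairs hmeas fun x => hbd _ _ _ _]
  have hint : Integrable (fun z : (Euc d × Euc e) × (Fin 4 → Euc d × Euc e) =>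
      pcovKernel id (Fin.cons z.1 z.2)) (P.prod (Measure.pi fun _ => P)) :=
    integrable_of_abs_le ((measurable_pcovKernel id).comp measurable_cons)
      fun _ => abs_pcovKernel_le _ _
  rw [integral_pi_succ P hint, ← integral_const_mul]
  refine integral_congr_ae (ae_of_all _ fun z => ?_)
  simp only
  rw [← integral_const_mul]
  -- The angle formula requires both copies to differ from the vertex; this is where the absence of
  -- atoms enters.
  have hne1 : ∀ i : Fin 4, ∀ᵐ w ∂(Measure.pi fun _ : Fin 4 => P), (w i).1 ≠ z.1 := by
    intro i
    have h : ∀ᵐ p ∂P, p.1 ≠ z.1 := by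
      rw [ae_iff]
      have := hP.1 z.1
      rw [Measure.fst_apply (measurableSet_singleton _)] at this
      simpa [Set.preimage] using this
    exact (measurePreserving_eval (fun _ : Fin 4 => P) i).quasiMeasurePreserving.ae h
  have hne2 : ∀ i : Fin 4, ∀ᵐ w ∂(Measure.pi fun _ : Fin 4 => P), (w i).2 ≠ z.2 := by
    intro i
    have h : ∀ᵐ p ∂P, p.2 ≠ z.2 := by
      rw [ae_iff]
      have := hP.2 z.2
      rw [Measure.snd_apply (measurableSet_singleton _)] at this
      simpa [Set.preimage] using this
    exact (measurePreserving_eval (fun _ : Fin 4 => P) i).quasiMeasurePreserving.ae h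
  refine integral_congr_ae ?_
  filter_upwards [ae_all_iff.2 hne1, ae_all_iff.2 hne2] with w hw1 hw2
  have hi : ∀ i j : Fin 4, Integrable (fun β : Metric.sphere (0 : Euc e) 1 =>
      below (β : Euc e) z.2 (w i).2 * below (β : Euc e) z.2 (w j).2) (surface e) := by
    intro i j
    refine integrable_of_abs_le (B := 1) ((measurable_below measurable_subtype_coe measurable_const
      measurable_const).mul (measurable_below measurable_subtype_coe measurable_const
      measurable_const)) fun β => ?_
    have h3 := below_nonneg (β : Euc e) z.2 (w i).2
    have h4 := below_nonneg (β : Euc e) z.2 (w j).2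
    rw [abs_of_nonneg (by positivity)]
    exact mul_le_one₀ (below_le_one _ _ _) h4 (below_le_one _ _ _)
  unfold covKernel
  simp only [integral_const_mul, integral_mul_const]
  rw [integral_sub_sub_add (hi 0 1) (hi 0 3) (hi 2 1) (hi 2 3)]
  rw [integral_below_mul_below (hw1 0) (hw1 1), integral_below_mul_below (hw2 0) (hw2 1),
    integral_below_mul_below (hw2 0) (hw2 3), integral_below_mul_below (hw2 2) (hw2 1),
    integral_below_mul_below (hw2 2) (hw2 3)]
  unfold pcovKernel
  simp only [id]
  rw [coAngle_eq (by decide) (by decide), coAngle_eq (by decide) (by decide),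
    coAngle_eq (by decide) (by decide), coAngle_eq (by decide) (by decide),
    coAngle_eq (by decide) (by decide)]
  change _ = sphereConst d * sphereConst e * ((Real.pi - InnerProductGeometry.angle ((w 0).1 - z.1)
    ((w 1).1 - z.1)) * ((Real.pi - InnerProductGeometry.angle ((w 0).2 - z.2) ((w 1).2 - z.2))
    - (Real.pi - InnerProductGeometry.angle ((w 0).2 - z.2) ((w 3).2 - z.2))
    - (Real.pi - InnerProductGeometry.angle ((w 2).2 - z.2) ((w 1).2 - z.2))
    + (Real.pi - InnerProductGeometry.angle ((w 2).2 - z.2) ((w 3).2 - z.2))))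
  ring

lemma integral_pcovKernel_of_injective {d e n : ℕ} {P : Measure (Euc d × Euc e)}
    [IsProbabilityMeasure P] {Ω : Type*} [MeasurableSpace Ω] {μ : Measure Ω}
    [IsProbabilityMeasure μ] {W : Fin n → Ω → Euc d × Euc e} (hW : ∀ i, HasLaw (W i) P μ)
    (hind : iIndepFun W μ) {I : Fin 5 → Fin n} (hI : Function.Injective I) :
    ∫ ω, pcovKernel I (fun i => W i ω) ∂μ
      = ∫ w, pcovKernel id w ∂(Measure.pi fun _ : Fin 5 => P) := by
  have hind' := hind.precomp hI
  have hlaw : μ.map (fun ω i => W (I i) ω) = Measure.pi fun _ => P := by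
    rw [(iIndepFun_iff_map_fun_eq_pi_map fun i => (hW (I i)).aemeasurable).1 hind']
    congr 1
    ext1 i
    exact (hW (I i)).map_eq
  rw [← hlaw, integral_map (aemeasurable_pi_lambda _ fun i => (hW (I i)).aemeasurable)
    (measurable_pcovKernel id).aestronglyMeasurable]
  refine integral_congr_ae (ae_of_all _ fun ω => ?_)
  -- The default value of the angle is decided by equality of indices, which an injective tuple
  -- preserves.
  simp [pcovKernel, coAngle, angleArr, hI.eq_iff]

/-! ### Uniform estimates on the sphere -/

lemma exists_isometry_apply_eq {d : ℕ} {u v : Euc d} (h : ‖u‖ = ‖v‖) :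
    ∃ R : Euc d ≃ₗᵢ[ℝ] Euc d, R u = v :=
  ⟨_, Submodule.reflection_sub h⟩

/-- The measure of the directions in the cap of cosine larger than `c` about `u`. -/
def capMass {d : ℕ} (c : ℝ) (u : Euc d) : ℝ := sigma (fun β : Euc d => c * ‖β‖ < inner ℝ β u)

lemma capMass_eq {d : ℕ} (c : ℝ) {u v : Euc d} (h : ‖u‖ = ‖v‖) : capMass c u = capMass c v := by
  obtain ⟨R, rfl⟩ := exists_isometry_apply_eq h
  unfold capMass
  rw [← sigma_isometry R (p := fun β : Euc d => c * ‖β‖ < inner ℝ β (R u))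
    (measurableSet_lt (by fun_prop) (by fun_prop))]
  simp

lemma capMass_pos {d : ℕ} {c : ℝ} (hc : c < 1) {u : Euc d} (hu : ‖u‖ = 1) : 0 < capMass c u := by
  unfold capMass sigma surface
  have ho : IsOpen {β : Metric.sphere (0 : Euc d) 1 | c * ‖(β : Euc d)‖ < inner ℝ (β : Euc d) u} :=
    isOpen_lt (by fun_prop) (by fun_prop)
  refine ENNReal.toReal_pos (ho.measure_ne_zero _ ⟨⟨u, by simpa using hu⟩, ?_⟩) (measure_ne_top _ _)
  simp [hu, hc]

/-- The measure of the directions that are nearly orthogonal to `u`. -/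
def bandMass {d : ℕ} (ε : ℝ) (u : Euc d) : ℝ :=
  sigma (fun α : Euc d => |inner ℝ α u| ≤ ε * ‖u‖)

lemma bandMass_eq {d : ℕ} (ε : ℝ) {u v : Euc d} (h : ‖u‖ = ‖v‖) : bandMass ε u = bandMass ε v := by
  obtain ⟨R, rfl⟩ := exists_isometry_apply_eq h
  unfold bandMass
  rw [← sigma_isometry R (p := fun α : Euc d => |inner ℝ α (R u)| ≤ ε * ‖R u‖)
    (measurableSet_le (by fun_prop) (by fun_prop))]
  simp

lemma bandMass_smul {d : ℕ} (ε : ℝ) (u : Euc d) {r : ℝ} (hr : 0 < r) :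
    bandMass ε (r • u) = bandMass ε u := by
  unfold bandMass
  congr 1
  ext α
  rw [inner_smul_right, norm_smul, abs_mul, Real.norm_eq_abs, abs_of_pos hr, mul_left_comm,
    mul_le_mul_iff_right₀ hr]

/-- The bands about one fixed hyperplane decrease to a null set, so continuity from above provides
ε. Invariance under rotation and scaling makes it serve every `u`. -/
lemma exists_bandMass_le {d : ℕ} (hd : 1 ≤ d) {η : ℝ} (hη : 0 < η) :
    ∃ ε > (0 : ℝ), ∀ u : Euc d, u ≠ 0 → bandMass ε u ≤ η := by
  set u₀ : Euc d := EuclideanSpace.single ⟨0, hd⟩ 1 with hu₀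
  have hn : ‖u₀‖ = 1 := by simp [hu₀]
  have hne : u₀ ≠ 0 := by rw [← norm_ne_zero_iff, hn]; norm_num
  set s : ℕ → Set (Metric.sphere (0 : Euc d) 1) := fun k =>
    {α | |inner ℝ (α : Euc d) u₀| ≤ 1 / ((k : ℝ) + 1) * ‖u₀‖} with hs
  have hanti : Antitone s := by
    intro k l hkl α hα
    simp only [hs, Set.mem_ofPred_eq, hn, mul_one] at hα ⊢
    exact hα.trans (Nat.one_div_le_one_div hkl)
  have hlim := tendsto_measure_iInter_atTop (μ := surface d) (s := s)
    (fun k => (measurableSet_le (by fun_prop) measurable_const).nullMeasurableSet)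
    hanti
    ⟨0, measure_ne_top _ _⟩
  have hinter : surface d (⋂ k, s k) = 0 := by
    refine measure_mono_null (fun α hα => ?_) (surface_hyperplane hne)
    have h1 : ∀ k : ℕ, |inner ℝ (α : Euc d) u₀| ≤ 1 / ((k : ℝ) + 1) := fun k => by
      have := Set.mem_iInter.1 hα k
      simpa only [hs, Set.mem_ofPred_eq, hn, mul_one] using this
    have h2 := ge_of_tendsto' (tendsto_one_div_add_atTop_nhds_zero_nat (𝕜 := ℝ)) h1
    exact abs_nonpos_iff.1 h2
  rw [hinter] at hlim
  have hev := hlim.eventually (gt_mem_nhds (ENNReal.ofReal_pos.2 hη))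
  obtain ⟨k, hk⟩ := hev.exists
  refine ⟨1 / ((k : ℝ) + 1), by positivity, fun u hu => ?_⟩
  · have h1 : bandMass (1 / ((k : ℝ) + 1)) u₀ ≤ η :=
      ENNReal.toReal_le_of_le_ofReal hη.le hk.le
    have h2 : ‖‖u‖⁻¹ • u‖ = ‖u₀‖ := by
      rw [hn, norm_smul, norm_inv, norm_norm, inv_mul_cancel₀ (norm_ne_zero_iff.2 hu)]
    rw [← bandMass_smul _ u (inv_pos.2 (norm_pos_iff.2 hu)), bandMass_eq _ h2]
    exact h1

/-! ### The probability integral transform -/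

/-- Without atoms the distribution function F is continuous and attains 1/4 and 3/4. Between these
quartiles lies mass 1/2, and there F(1 - F) ≥ 3/16. -/
lemma integral_cdf_mul_one_sub_ge (ρ : Measure ℝ) [IsProbabilityMeasure ρ] (hρ : ∀ t, ρ {t} = 0) :
    3 / 32 ≤ ∫ x, ρ.real (Set.Iic x) * (1 - ρ.real (Set.Iic x)) ∂ρ := by
  simp only [← cdf_eq_real]
  have hcont : Continuous (cdf ρ) := by
    rw [continuous_iff_continuousAt]
    intro x
    rw [continuousAt_iff_continuous_left'_right']
    refine ⟨?_, ((cdf ρ).right_continuous x).mono Set.Ioi_subset_Ici_self⟩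
    rw [(monotone_cdf ρ).continuousWithinAt_Iio_iff_leftLim_eq]
    have h := (cdf ρ).measure_singleton x
    rw [measure_cdf, hρ, eq_comm, ENNReal.ofReal_eq_zero] at h
    exact le_antisymm ((monotone_cdf ρ).leftLim_le le_rfl) (by linarith)
  have hivt : ∀ y : ℝ, 0 < y → y < 1 → ∃ x, cdf ρ x = y := by
    intro y h0 h1
    obtain ⟨a, ha⟩ := ((tendsto_cdf_atBot ρ).eventually (gt_mem_nhds h0)).exists
    obtain ⟨b, hb⟩ := ((tendsto_cdf_atTop ρ).eventually (lt_mem_nhds h1)).exists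
    exact mem_range_of_exists_le_of_exists_ge hcont ⟨a, ha.le⟩ ⟨b, hb.le⟩
  obtain ⟨a, ha⟩ := hivt (1 / 4) (by norm_num) (by norm_num)
  obtain ⟨b, hb⟩ := hivt (3 / 4) (by norm_num) (by norm_num)
  have hab : ρ.real (Set.Ioc a b) = 1 / 2 := by
    have h := (cdf ρ).measure_Ioc a b
    rw [measure_cdf, ha, hb] at h
    rw [Measure.real, h, ENNReal.toReal_ofReal (by norm_num)]
    norm_num
  have hm : Measurable fun x => cdf ρ x * (1 - cdf ρ x) :=
    hcont.measurable.mul (measurable_const.sub hcont.measurable)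
  have hle : ∀ x, (Set.Ioc a b).indicator (fun _ => (3 / 16 : ℝ)) x ≤ cdf ρ x * (1 - cdf ρ x) := by
    intro x
    by_cases hx : x ∈ Set.Ioc a b
    · rw [Set.indicator_of_mem hx]
      have h1 := monotone_cdf ρ hx.1.le
      have h2 := monotone_cdf ρ hx.2
      rw [ha] at h1
      rw [hb] at h2
      nlinarith
    · rw [Set.indicator_of_notMem hx]
      exact mul_nonneg (cdf_nonneg ρ x) (sub_nonneg.2 (cdf_le_one ρ x))
  calc (3 / 32 : ℝ) = ∫ x, (Set.Ioc a b).indicator (fun _ => (3 / 16 : ℝ)) x ∂ρ := by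
        rw [integral_indicator_const _ measurableSet_Ioc, hab]; norm_num
    _ ≤ _ := integral_mono ((integrable_const _).indicator measurableSet_Ioc)
        (integrable_of_abs_le (B := 1) hm fun x => by
          have h0 := cdf_nonneg ρ x
          have h1 := cdf_le_one ρ x
          rw [abs_of_nonneg (mul_nonneg h0 (sub_nonneg.2 h1))]
          nlinarith) hle

/-! ### Lower bound for the projection variance -/

/-- The probability that a copy of the vector precedes `z` in the direction `α`. -/
def projCdf {d : ℕ} (Q : Measure (Euc d)) (α z : Euc d) : ℝ := ∫ w, below α z w ∂Q

/-- The indicator that `w - z` is nearly orthogonal to `α`. -/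
def inBand {d : ℕ} (ε : ℝ) (α z w : Euc d) : ℝ :=
  if |inner ℝ α (w - z)| ≤ ε * ‖w - z‖ then 1 else 0

lemma inBand_nonneg {d : ℕ} (ε : ℝ) (α z w : Euc d) : 0 ≤ inBand ε α z w := by
  unfold inBand; split_ifs <;> norm_num

lemma inBand_le_one {d : ℕ} (ε : ℝ) (α z w : Euc d) : inBand ε α z w ≤ 1 := by
  unfold inBand; split_ifs <;> norm_num

lemma measurable_inBand {d : ℕ} (ε : ℝ) {X : Type*} [MeasurableSpace X] {a z w : X → Euc d}
    (ha : Measurable a) (hz : Measurable z) (hw : Measurable w) :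
    Measurable fun x => inBand ε (a x) (z x) (w x) := by
  unfold inBand
  refine Measurable.ite (measurableSet_le ?_ ?_) measurable_const measurable_const
  · exact continuous_abs.measurable.comp (by fun_prop)
  · fun_prop

lemma abs_below_le_one {d : ℕ} (α z w : Euc d) : |below α z w| ≤ 1 := by
  rw [abs_of_nonneg (below_nonneg _ _ _)]; exact below_le_one _ _ _

lemma abs_inBand_le_one {d : ℕ} (ε : ℝ) (α z w : Euc d) : |inBand ε α z w| ≤ 1 := by
  rw [abs_of_nonneg (inBand_nonneg _ _ _ _)]; exact inBand_le_one _ _ _ _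

lemma measurable_integral_right {X Y : Type*} [MeasurableSpace X] [MeasurableSpace Y]
    {Q : Measure Y} [SFinite Q] {F : X → Y → ℝ} (hF : Measurable fun p : X × Y => F p.1 p.2) :
    Measurable fun x => ∫ y, F x y ∂Q :=
  (hF.stronglyMeasurable.integral_prod_right').measurable

/-- `covAt` for the pair of a random vector with itself. -/
def selfCov {d : ℕ} (Q : Measure (Euc d)) (α β z : Euc d) : ℝ :=
  ∫ w, below α z w * below β z w ∂Q - projCdf Q α z * projCdf Q β z

section SelfCov

variable {d : ℕ} (Q : Measure (Euc d)) [IsProbabilityMeasure Q]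

lemma projCdf_mem (α z : Euc d) : 0 ≤ projCdf Q α z ∧ projCdf Q α z ≤ 1 := by
  refine ⟨integral_nonneg fun w => below_nonneg _ _ _, ?_⟩
  exact (le_abs_self _).trans (abs_integral_le_of_abs_le fun w => abs_below_le_one α z w)

lemma measurable_projCdf {X : Type*} [MeasurableSpace X] {a z : X → Euc d} (ha : Measurable a)
    (hz : Measurable z) : Measurable fun x => projCdf Q (a x) (z x) :=
  measurable_integral_right (F := fun x w => below (a x) (z x) w)
    (measurable_below (ha.comp measurable_fst) (hz.comp measurable_fst) measurable_snd)

lemma measurable_selfCov {X : Type*} [MeasurableSpace X] {a b z : X → Euc d} (ha : Measurable a)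
    (hb : Measurable b) (hz : Measurable z) :
    Measurable fun x => selfCov Q (a x) (b x) (z x) := by
  refine Measurable.sub ?_ ((measurable_projCdf Q ha hz).mul (measurable_projCdf Q hb hz))
  exact measurable_integral_right (F := fun x w => below (a x) (z x) w * below (b x) (z x) w)
    ((measurable_below (ha.comp measurable_fst) (hz.comp measurable_fst) measurable_snd).mul
      (measurable_below (hb.comp measurable_fst) (hz.comp measurable_fst) measurable_snd))

lemma abs_selfCov_le (α β z : Euc d) : |selfCov Q α β z| ≤ 2 := by
  have h1 : |∫ w, below α z w * below β z w ∂Q| ≤ 1 := abs_integral_le_of_abs_le fun w => by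
    rw [abs_mul]
    exact mul_le_one₀ (abs_below_le_one _ _ _) (abs_nonneg _) (abs_below_le_one _ _ _)
  have h2 : |projCdf Q α z * projCdf Q β z| ≤ 1 := by
    have ha := projCdf_mem Q α z
    have hb := projCdf_mem Q β z
    rw [abs_of_nonneg (mul_nonneg ha.1 hb.1)]
    exact mul_le_one₀ ha.2 hb.1 hb.2
  unfold selfCov
  exact (abs_sub _ _).trans (by linarith)

lemma pvarSq_eq_integral_selfCov :
    pvarSq Q = ∫ α, ∫ β, ∫ z, selfCov Q (α : Euc d) (β : Euc d) z ^ 2 ∂Q ∂(surface d)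
      ∂(surface d) := by
  have hdiag : Measurable fun x : Euc d => (x, x) := by fun_prop
  have : IsProbabilityMeasure (Q.map fun x => (x, x)) :=
    Measure.isProbabilityMeasure_map hdiag.aemeasurable
  unfold pvarSq
  rw [pcovSq_eq_integral_covAt]
  refine integral_congr_ae (ae_of_all _ fun α => integral_congr_ae (ae_of_all _ fun β => ?_))
  simp only
  have hemb : MeasurableEmbedding fun x : Euc d => (x, x) :=
    Continuous.measurableEmbedding (by fun_prop) fun x y h => congrArg Prod.fst h
  rw [hemb.integral_map]
  unfold covAt selfCov projCdf
  simp only [hemb.integral_map]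

/-- The probability of the band about the hyperplane through `z` orthogonal to `α`. -/
def bandProb {d : ℕ} (ε : ℝ) (Q : Measure (Euc d)) (α z : Euc d) : ℝ := ∫ w, inBand ε α z w ∂Q

lemma bandProb_mem (ε : ℝ) (α z : Euc d) : 0 ≤ bandProb ε Q α z ∧ bandProb ε Q α z ≤ 1 := by
  refine ⟨integral_nonneg fun w => inBand_nonneg _ _ _ _, ?_⟩
  exact (le_abs_self _).trans (abs_integral_le_of_abs_le fun w => abs_inBand_le_one ε α z w)

lemma measurable_bandProb (ε : ℝ) {X : Type*} [MeasurableSpace X] {a z : X → Euc d}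
    (ha : Measurable a) (hz : Measurable z) : Measurable fun x => bandProb ε Q (a x) (z x) :=
  measurable_integral_right (F := fun x w => inBand ε (a x) (z x) w)
    (measurable_inBand ε (ha.comp measurable_fst) (hz.comp measurable_fst) measurable_snd)

/-- If the indicators differ, the products of `w - z` with α and β lie on different sides of 0, so
each is at most their difference, hence at most ε‖w - z‖. -/
lemma below_sub_below_le {ε : ℝ} {α β : Euc d} (hαβ : ‖α - β‖ ≤ ε) (z w : Euc d) :
    |below α z w - below β z w| ≤ inBand ε α z w := by
  unfold below inBand
  have h1 : |inner ℝ α (w - z) - inner ℝ β (w - z)| ≤ ε * ‖w - z‖ := by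
    rw [← inner_sub_left]
    exact (abs_real_inner_le_norm _ _).trans (by gcongr)
  have h2 := abs_le.1 h1
  have h3 := abs_nonneg (inner ℝ α (w - z) - inner ℝ β (w - z))
  split_ifs with ha hb hc hc hb hc hc <;> norm_num
  · exact hc (abs_le.2 ⟨by linarith [h2.1], by linarith⟩)
  · exact hc (abs_le.2 ⟨by linarith, by linarith [h2.2]⟩)

/-- For β = α the covariance is F(1 - F). Moving β costs one band probability in the joint term and
at most one in the product term. -/
lemma selfCov_ge {ε : ℝ} {α β : Euc d} (hαβ : ‖α - β‖ ≤ ε) (z : Euc d) :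
    projCdf Q α z * (1 - projCdf Q α z) - 2 * bandProb ε Q α z ≤ selfCov Q α β z := by
  have ia : Integrable (fun w => below α z w) Q := integrable_of_abs_le
    (measurable_below measurable_const measurable_const measurable_id) (abs_below_le_one α z)
  have ib : Integrable (fun w => below β z w) Q := integrable_of_abs_le
    (measurable_below measurable_const measurable_const measurable_id) (abs_below_le_one β z)
  have ic : Integrable (fun w => inBand ε α z w) Q := integrable_of_abs_le
    (measurable_inBand ε measurable_const measurable_const measurable_id) (abs_inBand_le_one ε α z)
  have iab : Integrable (fun w => below α z w * below β z w) Q := integrable_of_abs_le (B := 1)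
    ((measurable_below measurable_const measurable_const measurable_id).mul
      (measurable_below measurable_const measurable_const measurable_id)) fun w => by
      rw [abs_mul]
      exact mul_le_one₀ (abs_below_le_one _ _ _) (abs_nonneg _) (abs_below_le_one _ _ _)
  have h1 : projCdf Q α z - bandProb ε Q α z ≤ ∫ w, below α z w * below β z w ∂Q := by
    unfold projCdf bandProb
    rw [← integral_sub ia ic]
    refine integral_mono (ia.sub ic) iab fun w => ?_
    have hw := abs_le.1 (below_sub_below_le hαβ z w)
    have h0 := below_nonneg α z w
    have h0' := below_le_one β z w
    have hc := inBand_nonneg ε α z w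
    rcases (show below α z w = 0 ∨ below α z w = 1 by unfold below; split_ifs <;> simp) with h | h
    · simp only [h]; linarith
    · simp only [h] at hw ⊢; linarith [hw.2]
  have h2 : projCdf Q β z ≤ projCdf Q α z + bandProb ε Q α z := by
    unfold projCdf bandProb
    rw [← integral_add ia ic]
    refine integral_mono ib (ia.add ic) fun w => ?_
    have hw := abs_le.1 (below_sub_below_le hαβ z w)
    simp only
    linarith [hw.1]
  have hF := projCdf_mem Q α z
  have hD := bandProb_mem Q ε α z
  unfold selfCov
  nlinarith [mul_le_mul_of_nonneg_left h2 hF.1, mul_le_mul_of_nonneg_right hF.2 hD.1]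

lemma ae_sub_ne_zero (hQ : ∀ v, Q {v} = 0) :
    ∀ᵐ (p : Euc d × Euc d) ∂(Q.prod Q), p.2 - p.1 ≠ 0 := by
  rw [ae_iff]
  have hm : MeasurableSet {p : Euc d × Euc d | ¬ (p.2 - p.1 ≠ 0)} := by
    simp only [ne_eq, not_not]
    exact measurableSet_eq_fun (by fun_prop) measurable_const
  rw [Measure.measure_prod_null hm]
  refine ae_of_all _ fun x => measure_mono_null (fun y hy => ?_) (hQ x)
  simpa [sub_eq_zero] using hy

/-- Two independent copies differ almost surely, and a given nonzero difference is orthogonal to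
almost no direction. By Fubini almost every projection separates independent copies; an atom of mass
a would make them agree with probability at least a². -/
lemma ae_projection_noAtoms (hQ : ∀ v, Q {v} = 0) :
    ∀ᵐ (α : Metric.sphere (0 : Euc d) 1) ∂(surface d), ∀ t : ℝ,
      Q {w | inner ℝ (α : Euc d) w = t} = 0 := by
  have hs : MeasurableSet {x : Metric.sphere (0 : Euc d) 1 × (Euc d × Euc d) |
      inner ℝ (x.1 : Euc d) (x.2.2 - x.2.1) ≠ 0} :=
    (measurableSet_eq_fun (by fun_prop) measurable_const).compl
  have h := (Measure.ae_ae_comm (μ := surface d) (ν := Q.prod Q)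
    (p := fun α p => inner ℝ (α : Euc d) (p.2 - p.1) ≠ 0) hs).2 (by
      filter_upwards [ae_sub_ne_zero Q hQ] with p hp
      rw [ae_iff]
      simpa using surface_hyperplane hp)
  filter_upwards [h] with α hα t
  rw [ae_iff] at hα
  have hsub : {w | inner ℝ (α : Euc d) w = t} ×ˢ {w | inner ℝ (α : Euc d) w = t}
      ⊆ {p : Euc d × Euc d | ¬ inner ℝ (α : Euc d) (p.2 - p.1) ≠ 0} := by
    rintro ⟨w, w'⟩ ⟨h1, h2⟩
    simp only [Set.mem_ofPred_eq] at h1 h2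
    simp [inner_sub_right, h1, h2]
  have h0 := measure_mono_null hsub hα
  rw [Measure.prod_prod] at h0
  exact mul_self_eq_zero.1 h0

lemma integral_projCdf_ge {α : Euc d} (hα : ∀ t : ℝ, Q {w | inner ℝ α w = t} = 0) :
    3 / 32 ≤ ∫ z, projCdf Q α z * (1 - projCdf Q α z) ∂Q := by
  have hm : Measurable fun w : Euc d => (inner ℝ α w : ℝ) := by fun_prop
  have : IsProbabilityMeasure (Q.map fun w : Euc d => (inner ℝ α w : ℝ)) :=
    Measure.isProbabilityMeasure_map hm.aemeasurable
  have h := integral_cdf_mul_one_sub_ge (Q.map fun w : Euc d => (inner ℝ α w : ℝ)) fun t => by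
    rw [Measure.map_apply hm (measurableSet_singleton t)]
    exact hα t
  rw [integral_map hm.aemeasurable] at h
  · refine h.trans_eq (integral_congr_ae (ae_of_all _ fun z => ?_))
    have e : (Q.map fun w : Euc d => (inner ℝ α w : ℝ)).real (Set.Iic (inner ℝ α z))
        = projCdf Q α z := by
      rw [map_measureReal_apply hm measurableSet_Iic, ← integral_indicator_one (hm measurableSet_Iic)]
      refine integral_congr_ae (ae_of_all _ fun w => ?_)
      simp only [below, inner_sub_right, sub_nonpos]
      split_ifs with hw
      · exact Set.indicator_of_mem (s := (fun w => inner ℝ α w) ⁻¹' Set.Iic (inner ℝ α z)) hw _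
      · exact Set.indicator_of_notMem (s := (fun w => inner ℝ α w) ⁻¹' Set.Iic (inner ℝ α z)) hw _
    simp only [e]
  · simp only [← cdf_eq_real]
    have := (monotone_cdf (Q.map fun w : Euc d => (inner ℝ α w : ℝ))).measurable
    exact (this.mul (measurable_const.sub this)).aestronglyMeasurable

lemma integral_inBand (ε : ℝ) (z w : Euc d) :
    ∫ α, inBand ε (α : Euc d) z w ∂(surface d) = bandMass ε (w - z) := by
  have hs : MeasurableSet {α : Metric.sphere (0 : Euc d) 1 |
      |inner ℝ (α : Euc d) (w - z)| ≤ ε * ‖w - z‖} :=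
    measurableSet_le (by fun_prop) measurable_const
  unfold bandMass sigma
  rw [← integral_indicator_one hs]
  refine integral_congr_ae (ae_of_all _ fun α => ?_)
  simp only [inBand]
  split_ifs with h
  · exact (Set.indicator_of_mem (s := {α : Metric.sphere (0 : Euc d) 1 |
      |inner ℝ (α : Euc d) (w - z)| ≤ ε * ‖w - z‖}) h (1 : Metric.sphere (0 : Euc d) 1 → ℝ)).symm
  · exact (Set.indicator_of_notMem (s := {α : Metric.sphere (0 : Euc d) 1 |
      |inner ℝ (α : Euc d) (w - z)| ≤ ε * ‖w - z‖}) h (1 : Metric.sphere (0 : Euc d) 1 → ℝ)).symm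

lemma integral_bandProb_eq (ε : ℝ) (α : Euc d) :
    ∫ z, bandProb ε Q α z ∂Q = ∫ p, inBand ε α p.1 p.2 ∂(Q.prod Q) :=
  (integral_prod (fun p : Euc d × Euc d => inBand ε α p.1 p.2)
    (integrable_of_abs_le (measurable_inBand ε measurable_const measurable_fst measurable_snd)
      fun _ => abs_inBand_le_one _ _ _ _)).symm

/-- By Fubini the directions are integrated first: for two distinct points, those whose band catches
the pair have measure at most η. -/
lemma integral_bandProb_le {ε η : ℝ} (hη : ∀ u : Euc d, u ≠ 0 → bandMass ε u ≤ η)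
    (hQ : ∀ v, Q {v} = 0) :
    ∫ α, ∫ z, bandProb ε Q (α : Euc d) z ∂Q ∂(surface d) ≤ η := by
  have hint : Integrable (fun x : Metric.sphere (0 : Euc d) 1 × (Euc d × Euc d) =>
      inBand ε (x.1 : Euc d) x.2.1 x.2.2) ((surface d).prod (Q.prod Q)) :=
    integrable_of_abs_le (measurable_inBand ε (by fun_prop) (by fun_prop) (by fun_prop))
      fun x => abs_inBand_le_one _ _ _ _
  have hswap := integral_integral_swap (f := fun (α : Metric.sphere (0 : Euc d) 1)
    (p : Euc d × Euc d) => inBand ε (α : Euc d) p.1 p.2) hint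
  simp only [integral_bandProb_eq]
  rw [hswap]
  simp only [integral_inBand]
  have hi : Integrable (fun p : Euc d × Euc d => bandMass ε (p.2 - p.1)) (Q.prod Q) := by
    simpa only [integral_inBand] using hint.integral_prod_right
  refine (integral_mono_ae hi (integrable_const η) ?_).trans (by simp)
  filter_upwards [ae_sub_ne_zero Q hQ] with p hp using hη _ hp

lemma measureReal_mul_le_integral {X : Type*} [MeasurableSpace X] {μ : Measure X}
    [IsFiniteMeasure μ] {A : Set X} (hA : MeasurableSet A) {f : X → ℝ} (hf : Integrable f μ)
    (h0 : ∀ x, 0 ≤ f x) {m : ℝ} (hm : ∀ x ∈ A, m ≤ f x) : μ.real A * m ≤ ∫ x, f x ∂μ := by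
  rw [← smul_eq_mul, ← integral_indicator_const _ hA]
  refine integral_mono ((integrable_const _).indicator hA) hf fun x => ?_
  by_cases h : x ∈ A
  · rw [Set.indicator_of_mem h]; exact hm x h
  · rw [Set.indicator_of_notMem h]; exact h0 x

lemma integrable_affine_comb {X : Type*} [MeasurableSpace X] {μ : Measure X} [IsFiniteMeasure μ]
    {f g : X → ℝ} (hf : Integrable f μ) (hg : Integrable g μ) :
    Integrable (fun x => f x / 8 - g x / 4 - 1 / 256) μ :=
  ((hf.div_const 8).sub (hg.div_const 4)).sub (integrable_const _)

lemma integral_affine_comb {X : Type*} [MeasurableSpace X] {μ : Measure X} [IsFiniteMeasure μ]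
    {f g : X → ℝ} (hf : Integrable f μ) (hg : Integrable g μ) :
    ∫ x, (f x / 8 - g x / 4 - 1 / 256) ∂μ
      = (∫ x, f x ∂μ) / 8 - (∫ x, g x ∂μ) / 4 - μ.real Set.univ / 256 := by
  have h1 := integral_sub' ((hf.div_const 8).sub (hg.div_const 4))
    (integrable_const (μ := μ) (1 / 256 : ℝ))
  have h2 := integral_sub' (hf.div_const 8) (hg.div_const 4)
  rw [h2, integral_div, integral_div, integral_const, smul_eq_mul] at h1
  rw [← mul_one_div (μ.real Set.univ), ← h1]
  rfl

/-- The mean over `z` of the variance of the indicator that a copy precedes `z`. -/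
def meanVar {d : ℕ} (Q : Measure (Euc d)) (α : Euc d) : ℝ :=
  ∫ z, projCdf Q α z * (1 - projCdf Q α z) ∂Q

/-- The mean over `z` of the band probability. -/
def meanBand {d : ℕ} (ε : ℝ) (Q : Measure (Euc d)) (α : Euc d) : ℝ := ∫ z, bandProb ε Q α z ∂Q

/-- The mean over `z` of the squared covariance. -/
def meanSqCov {d : ℕ} (Q : Measure (Euc d)) (α β : Euc d) : ℝ := ∫ z, selfCov Q α β z ^ 2 ∂Q

lemma measurable_projCdf_mul {X : Type*} [MeasurableSpace X] {a z : X → Euc d} (ha : Measurable a)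
    (hz : Measurable z) :
    Measurable fun x => projCdf Q (a x) (z x) * (1 - projCdf Q (a x) (z x)) :=
  (measurable_projCdf Q ha hz).mul (measurable_const.sub (measurable_projCdf Q ha hz))

lemma abs_projCdf_mul_le (α z : Euc d) : |projCdf Q α z * (1 - projCdf Q α z)| ≤ 1 := by
  have h := projCdf_mem Q α z
  rw [abs_of_nonneg (mul_nonneg h.1 (sub_nonneg.2 h.2))]
  nlinarith

lemma abs_bandProb_le (ε : ℝ) (α z : Euc d) : |bandProb ε Q α z| ≤ 1 := by
  rw [abs_of_nonneg (bandProb_mem Q ε α z).1]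
  exact (bandProb_mem Q ε α z).2

lemma abs_selfCov_sq_le (α β z : Euc d) : |selfCov Q α β z ^ 2| ≤ 4 := by
  rw [abs_pow]
  nlinarith [abs_selfCov_le Q α β z, abs_nonneg (selfCov Q α β z)]

lemma integrable_meanVar :
    Integrable (fun α : Metric.sphere (0 : Euc d) 1 => meanVar Q α) (surface d) :=
  integrable_of_abs_le (measurable_integral_right (F := fun (α : Metric.sphere (0 : Euc d) 1) z =>
    projCdf Q (α : Euc d) z * (1 - projCdf Q (α : Euc d) z))
    (measurable_projCdf_mul Q (by fun_prop) measurable_snd))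
    fun α => abs_integral_le_of_abs_le (abs_projCdf_mul_le Q α)

lemma integrable_meanBand (ε : ℝ) :
    Integrable (fun α : Metric.sphere (0 : Euc d) 1 => meanBand ε Q α) (surface d) :=
  integrable_of_abs_le (measurable_integral_right (F := fun (α : Metric.sphere (0 : Euc d) 1) z =>
    bandProb ε Q (α : Euc d) z) (measurable_bandProb Q ε (by fun_prop) measurable_snd))
    fun α => abs_integral_le_of_abs_le (abs_bandProb_le Q ε α)

lemma measurable_meanSqCov : Measurable fun x : Metric.sphere (0 : Euc d) 1 ×
    Metric.sphere (0 : Euc d) 1 => meanSqCov Q (x.1 : Euc d) (x.2 : Euc d) :=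
  measurable_integral_right (F := fun (x : Metric.sphere (0 : Euc d) 1 ×
    Metric.sphere (0 : Euc d) 1) z => selfCov Q (x.1 : Euc d) (x.2 : Euc d) z ^ 2)
    ((measurable_selfCov Q (by fun_prop) (by fun_prop) measurable_snd).pow_const 2)

lemma abs_meanSqCov_le (α β : Euc d) : |meanSqCov Q α β| ≤ 4 :=
  abs_integral_le_of_abs_le (abs_selfCov_sq_le Q α β)

/-- On close pairs of directions, `t² ≥ t / 8 - 1 / 256` bounds the squared covariance. -/
lemma meanSqCov_ge {ε : ℝ} {α β : Euc d} (hαβ : ‖α - β‖ ≤ ε) :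
    meanVar Q α / 8 - meanBand ε Q α / 4 - 1 / 256 ≤ meanSqCov Q α β := by
  have hVi : Integrable (fun z => projCdf Q α z * (1 - projCdf Q α z)) Q :=
    integrable_of_abs_le (measurable_projCdf_mul Q measurable_const measurable_id)
      (abs_projCdf_mul_le Q α)
  have hDi : Integrable (fun z => bandProb ε Q α z) Q :=
    integrable_of_abs_le (measurable_bandProb Q ε measurable_const measurable_id)
      (abs_bandProb_le Q ε α)
  have e := integral_affine_comb hVi hDi
  rw [probReal_univ] at e
  unfold meanVar meanBand meanSqCov
  rw [← e]
  refine integral_mono (integrable_affine_comb hVi hDi) (integrable_of_abs_le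
    ((measurable_selfCov Q measurable_const measurable_const measurable_id).pow_const 2)
    (abs_selfCov_sq_le Q α β)) fun z => ?_
  have h1 := selfCov_ge Q hαβ z
  simp only
  -- The tangent line of t² at 1/16 gives a bound linear in t, so a lower bound for t can be
  -- inserted even where it is negative, and then averaged.
  nlinarith [sq_nonneg (selfCov Q α β z - 1 / 16)]

lemma capMass_mul_le_integral_meanSqCov {ε : ℝ} (hε : 0 < ε) (α : Metric.sphere (0 : Euc d) 1) :
    capMass (1 - ε ^ 2 / 2) (α : Euc d) *
        (meanVar Q (α : Euc d) / 8 - meanBand ε Q (α : Euc d) / 4 - 1 / 256)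
      ≤ ∫ β, meanSqCov Q (α : Euc d) (β : Euc d) ∂(surface d) := by
  refine measureReal_mul_le_integral (measurableSet_lt (by fun_prop) (by fun_prop))
    (integrable_of_abs_le ((measurable_meanSqCov Q).comp measurable_prodMk_left)
      fun β => abs_meanSqCov_le Q _ _) (fun β => integral_nonneg fun z => sq_nonneg _)
    fun β hβ => meanSqCov_ge Q ?_
  have hαn : ‖(α : Euc d)‖ = 1 := by simp
  have hβn : ‖(β : Euc d)‖ = 1 := by simp
  have h : (1 - ε ^ 2 / 2) * ‖(β : Euc d)‖ < inner ℝ (β : Euc d) (α : Euc d) := hβ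
  -- For unit vectors ‖α - β‖² = 2 - 2⟨α, β⟩, so the cap of cosine 1 - ε²/2 is the ball of radius ε.
  rw [← sq_le_sq₀ (norm_nonneg _) hε.le, norm_sub_sq_real, hαn, hβn, real_inner_comm]
  rw [hβn] at h
  linarith

/-- The projection variance of a law without atoms is bounded below by a constant that only
depends on the dimension. -/
lemma exists_pvarSq_ge (d : ℕ) (hd : 1 ≤ d) :
    ∃ c > (0 : ℝ), ∀ (Q : Measure (Euc d)) [IsProbabilityMeasure Q], (∀ v, Q {v} = 0) →
      c ≤ pvarSq Q := by
  set S := sigma (fun _ : Euc d => True) with hS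
  set u₀ : Euc d := EuclideanSpace.single ⟨0, hd⟩ 1 with hu₀
  have hn : ‖u₀‖ = 1 := by simp [hu₀]
  have hSpos : 0 < S :=
    (capMass_pos (c := 0) (by norm_num) hn).trans_le (sigma_mono fun _ _ => trivial)
  -- Budget in units of S/256: the variance term contributes at least 3, the bands cost at most 1
  -- when η = S/64, the tangent constant costs 1, and 1 remains.
  obtain ⟨ε, hε, hband⟩ := exists_bandMass_le hd (η := S / 64) (by positivity)
  set s := capMass (1 - ε ^ 2 / 2) u₀ with hs
  have hspos : 0 < s := capMass_pos (by nlinarith [pow_pos hε 2]) hn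
  refine ⟨s * S / 256, by positivity, fun Q _ hQ => ?_⟩
  rw [pvarSq_eq_integral_selfCov]
  have houter : Integrable (fun x : Metric.sphere (0 : Euc d) 1 × Metric.sphere (0 : Euc d) 1 =>
      meanSqCov Q (x.1 : Euc d) (x.2 : Euc d)) ((surface d).prod (surface d)) :=
    integrable_of_abs_le (measurable_meanSqCov Q) fun x => abs_meanSqCov_le Q _ _
  have hcap : ∀ α : Metric.sphere (0 : Euc d) 1,
      s * (meanVar Q (α : Euc d) / 8 - meanBand ε Q (α : Euc d) / 4 - 1 / 256)
        ≤ ∫ β, meanSqCov Q (α : Euc d) (β : Euc d) ∂(surface d) := fun α => by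
    rw [hs, capMass_eq (1 - ε ^ 2 / 2) (v := (α : Euc d)) (by rw [hn]; simp)]
    exact capMass_mul_le_integral_meanSqCov Q hε α
  have hVint := integrable_meanVar Q
  have hDint := integrable_meanBand Q ε
  have hDle : ∫ α, meanBand ε Q (α : Euc d) ∂(surface d) ≤ S / 64 := integral_bandProb_le Q hband hQ
  have hSreal : (surface d).real Set.univ = S := by simp [hS, sigma]
  have hVge : 3 / 32 * S ≤ ∫ α, meanVar Q (α : Euc d) ∂(surface d) := by
    have h : ∫ _α, (3 / 32 : ℝ) ∂(surface d) ≤ ∫ α, meanVar Q (α : Euc d) ∂(surface d) := by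
      refine integral_mono_ae (integrable_const _) hVint ?_
      filter_upwards [ae_projection_noAtoms Q hQ] with α hα using integral_projCdf_ge Q hα
    rwa [integral_const, hSreal, smul_eq_mul, mul_comm] at h
  have hlin := integral_affine_comb hVint hDint
  rw [hSreal] at hlin
  calc s * S / 256 ≤ s * ((∫ α, meanVar Q (α : Euc d) ∂(surface d)) / 8
        - (∫ α, meanBand ε Q (α : Euc d) ∂(surface d)) / 4 - S / 256) := by
        rw [mul_div_assoc]
        gcongr
        linarith
    _ = ∫ α, s * (meanVar Q (α : Euc d) / 8 - meanBand ε Q (α : Euc d) / 4 - 1 / 256)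
          ∂(surface d) := by
        rw [integral_const_mul, hlin]
    _ ≤ _ := integral_mono ((integrable_affine_comb hVint hDint).const_mul s)
          houter.integral_prod_left hcap

end SelfCov

/-! ### Concentration of the sample covariance and of the correlation -/

/-- The population value of the V-statistic `samplePcovSq`: the squared projection covariance with
plane angles in place of solid angles. -/
def popAngle {d e : ℕ} (P : Measure (Euc d × Euc e)) : ℝ :=
  ∫ w, pcovKernel id w ∂(Measure.pi fun _ : Fin 5 => P)

/-- Concentration of the sample projection covariance about its population value. -/
lemma measure_samplePcovSq_sub_ge_le {d e n : ℕ} (hn : 1 ≤ n) {P : Measure (Euc d × Euc e)}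
    [IsProbabilityMeasure P] {Ω : Type*} [MeasurableSpace Ω] {μ : Measure Ω}
    [IsProbabilityMeasure μ] {W : Fin n → Ω → Euc d × Euc e} (hW : ∀ i, HasLaw (W i) P μ)
    (hind : iIndepFun W μ) {η : ℝ} (hη : 0 < η) (hbias : 200 * Real.pi ^ 2 / n ≤ η / 2) :
    μ.real {ω | η ≤ |samplePcovSq (fun i => (W i ω).1) (fun i => (W i ω).2) - popAngle P|}
      ≤ 2 * Real.exp (-(η ^ 2 * n / (12800 * Real.pi ^ 4))) := by
  have hn0 : (0 : ℝ) < n := by exact_mod_cast hn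
  have hpi := Real.pi_pos
  have hWm : ∀ i, AEMeasurable (W i) μ := fun i => (hW i).aemeasurable
  have hTint : ∀ I, Integrable (fun ω => pcovKernel I (fun i => W i ω)) μ := fun I =>
    Integrable.of_bound ((measurable_pcovKernel I).comp_aemeasurable
      (aemeasurable_pi_lambda _ hWm)).aestronglyMeasurable (4 * Real.pi ^ 2)
      (ae_of_all _ fun ω => abs_pcovKernel_le I _)
  have hb := abs_integral_vStat_sub_le hn (T := pcovKernel (d := d) (e := e)) abs_pcovKernel_le
    hTint (θ := popAngle P) (abs_integral_le_of_abs_le fun w => abs_pcovKernel_le id w)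
    fun I hI => integral_pcovKernel_of_injective hW hind hI
  have hmeas : Measurable fun z : Fin n → Euc d × Euc e => vStat pcovKernel z := by
    unfold vStat
    exact (Finset.measurable_sum _ fun I _ => measurable_pcovKernel I).const_mul _
  have hmd := measure_abs_ge_le_of_bounded_differences hW hind hmeas
    (fun x => abs_vStat_le hn abs_pcovKernel_le x)
    (fun x i s => abs_vStat_update_sub_le hn abs_pcovKernel_le pcovKernel_congr x i s)
    (ε := η / 2) (by positivity)
  -- With m = 5 and B = 4π², one observation moves the statistic by at most 40π²/n and the bias is
  -- at most 200π²/n. Half of η absorbs the bias, the other half goes into McDiarmid's inequality.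
  have e : -(η / 2) ^ 2 / (2 * (n * (((5 : ℕ) : ℝ) * (2 * (4 * Real.pi ^ 2)) / n) ^ 2))
      = -(η ^ 2 * n / (12800 * Real.pi ^ 4)) := by
    push_cast
    field_simp
    ring
  rw [e] at hmd
  refine (measureReal_mono fun ω hω => ?_).trans hmd
  simp only [Set.mem_ofPred_eq] at hω ⊢
  rw [samplePcovSq_eq_vStat hn] at hω
  have h1 : |∫ ω, vStat pcovKernel (fun i => W i ω) ∂μ - popAngle P| ≤ η / 2 := by
    refine hb.trans (le_trans (le_of_eq ?_) hbias)
    push_cast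
    ring
  have h2 := abs_sub_le (vStat pcovKernel fun i => W i ω)
    (∫ ω, vStat pcovKernel (fun i => W i ω) ∂μ) (popAngle P)
  linarith

lemma sphereConst_pos {d : ℕ} (hd : 1 ≤ d) : 0 < sphereConst d := by
  have hn : ‖(EuclideanSpace.single ⟨0, hd⟩ 1 : Euc d)‖ = 1 := by simp
  have hS : 0 < sigma (fun _ : Euc d => True) :=
    (capMass_pos (c := 0) (by norm_num) hn).trans_le (sigma_mono fun _ _ => trivial)
  have := Real.pi_pos
  unfold sphereConst
  positivity

/-- The law of the pair of a random vector with itself. -/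
def diagLaw {d : ℕ} (Q : Measure (Euc d)) : Measure (Euc d × Euc d) := Q.map fun x => (x, x)

instance {d : ℕ} (Q : Measure (Euc d)) [IsProbabilityMeasure Q] :
    IsProbabilityMeasure (diagLaw Q) :=
  Measure.isProbabilityMeasure_map (by fun_prop)

lemma noAtomMarginals_diagLaw {d : ℕ} {Q : Measure (Euc d)} (hQ : ∀ v, Q {v} = 0) :
    NoAtomMarginals (diagLaw Q) := by
  have h : Measurable fun x : Euc d => (x, x) := by fun_prop
  constructor
  · intro v
    rw [diagLaw, Measure.fst, Measure.map_map measurable_fst h]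
    exact (congrArg (fun R : Measure (Euc d) => R {v}) Measure.map_id).trans (hQ v)
  · intro v
    rw [diagLaw, Measure.snd, Measure.map_map measurable_snd h]
    exact (congrArg (fun R : Measure (Euc d) => R {v}) Measure.map_id).trans (hQ v)

lemma pvarSq_eq {d : ℕ} {Q : Measure (Euc d)} [IsProbabilityMeasure Q] (hQ : ∀ v, Q {v} = 0) :
    pvarSq Q = sphereConst d ^ 2 * popAngle (diagLaw Q) := by
  rw [sq]
  exact pcovSq_eq (diagLaw Q) (noAtomMarginals_diagLaw hQ)

lemma exists_popAngle_diagLaw_ge (d : ℕ) (hd : 1 ≤ d) :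
    ∃ m > (0 : ℝ), ∀ (Q : Measure (Euc d)) [IsProbabilityMeasure Q], (∀ v, Q {v} = 0) →
      m ≤ popAngle (diagLaw Q) := by
  obtain ⟨c, hc, h⟩ := exists_pvarSq_ge d hd
  have hs := sphereConst_pos hd
  refine ⟨c / sphereConst d ^ 2, by positivity, fun Q _ hQ => ?_⟩
  rw [div_le_iff₀ (by positivity), mul_comm, ← pvarSq_eq hQ]
  exact h Q hQ

/-- Each dimensional constant appears once in the numerator and, as the root of its square, once in
the denominator. -/
lemma pcSq_eq {d e : ℕ} (hd : 1 ≤ d) (he : 1 ≤ e) {P : Measure (Euc d × Euc e)}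
    [IsProbabilityMeasure P] (hP : NoAtomMarginals P) :
    pcSq P = popAngle P / (√(popAngle (diagLaw P.fst)) * √(popAngle (diagLaw P.snd))) := by
  have h1 := sphereConst_pos hd
  have h2 := sphereConst_pos he
  rw [pcSq, pvarSq_eq hP.1, pvarSq_eq hP.2, Real.sqrt_mul (by positivity),
    Real.sqrt_mul (by positivity), Real.sqrt_sq h1.le, Real.sqrt_sq h2.le, pcovSq_eq P hP,
    mul_mul_mul_comm, mul_div_mul_left _ _ (by positivity)]
  rfl

/-- A ratio `a / (√x √y)` at least halves only if one of its entries moves by a fixed fraction. -/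
lemma half_ratio_le {a x y a' x' y' m η : ℝ} (hη : 0 < η) (hx : m ≤ x) (hy : m ≤ y)
    (hηm : 4 * η ≤ m) (hηa : 4 * η ≤ a) (ha' : |a' - a| < η) (hx' : |x' - x| < η)
    (hy' : |y' - y| < η) : a / (√x * √y) / 2 ≤ a' / (√x' * √y') := by
  rw [abs_lt] at ha' hx' hy'
  have hx0 : 0 < x' := by linarith
  have hy0 : 0 < y' := by linarith
  have hxp : 0 < x := by linarith
  have hyp : 0 < y := by linarith
  -- The denominator grows by a factor of at most 5/4 and the numerator keeps at least 3/4; their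
  -- quotient 3/5 exceeds 1/2.
  have h1 : √x' ≤ √(5 / 4 * x) := Real.sqrt_le_sqrt (by linarith)
  have h2 : √y' ≤ √(5 / 4 * y) := Real.sqrt_le_sqrt (by linarith)
  have h3 : √x' * √y' ≤ 5 / 4 * (√x * √y) := by
    refine (mul_le_mul h1 h2 (Real.sqrt_nonneg _) (Real.sqrt_nonneg _)).trans (le_of_eq ?_)
    rw [Real.sqrt_mul (by norm_num), Real.sqrt_mul (by norm_num), mul_mul_mul_comm,
      Real.mul_self_sqrt (by norm_num)]
  have hs : 0 < √x * √y := by positivity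
  rw [div_div, div_le_div_iff₀ (by positivity) (by positivity)]
  calc a * (√x' * √y') ≤ a * (5 / 4 * (√x * √y)) := by gcongr; linarith
    _ ≤ a' * (√x * √y * 2) := by nlinarith

lemma hasLaw_comp {X Y Ω : Type*} [MeasurableSpace X] [MeasurableSpace Y] [MeasurableSpace Ω]
    {μ : Measure Ω} {P : Measure X} {W : Ω → X} (hW : HasLaw W P μ) {f : X → Y}
    (hf : Measurable f) : HasLaw (fun ω => f (W ω)) (P.map f) μ where
  aemeasurable := hf.comp_aemeasurable hW.aemeasurable
  map_eq := by
    rw [← hW.map_eq, AEMeasurable.map_map_of_aemeasurable hf.aemeasurable hW.aemeasurable]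
    rfl

/-- Exponential bound for the probability that the sample projection correlation of a pair falls
below half its population value. -/
lemma exists_measure_samplePcSq_lt_le (d e : ℕ) (hd : 1 ≤ d) (he : 1 ≤ e) {c₃ κ : ℝ} (hc₃ : 0 < c₃)
    (hκ₀ : 0 ≤ κ) :
    ∃ C > (0 : ℝ), ∃ c₄ > (0 : ℝ), ∀ (n : ℕ), 1 ≤ n →
      ∀ (P : Measure (Euc d × Euc e)) [IsProbabilityMeasure P], NoAtomMarginals P →
      2 * c₃ * (n : ℝ) ^ (-κ) ≤ pcSq P →
      ∀ {Ω : Type*} [MeasurableSpace Ω] (μ : Measure Ω) [IsProbabilityMeasure μ]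
        (W : Fin n → Ω → Euc d × Euc e), (∀ i, HasLaw (W i) P μ) → iIndepFun W μ →
      μ.real {ω | samplePcSq (fun i => (W i ω).1) (fun i => (W i ω).2) < pcSq P / 2}
        ≤ C * Real.exp (-c₄ * (n : ℝ) ^ (1 - 2 * κ)) := by
  have hpi := Real.pi_pos
  obtain ⟨m₁, hm₁, hlow₁⟩ := exists_popAngle_diagLaw_ge d hd
  obtain ⟨m₂, hm₂, hlow₂⟩ := exists_popAngle_diagLaw_ge e he
  set m := min m₁ m₂ with hm
  have hm0 : 0 < m := lt_min hm₁ hm₂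
  -- With η = η₀ n^(-κ), the first entry makes 4η at most the signal 2c₃ n^(-κ) m in the numerator,
  -- the second makes 4η at most the lower bound m of the denominators.
  set η₀ := min (c₃ * m / 2) (m / 4) with hη₀
  have hη₀pos : 0 < η₀ := lt_min (by positivity) (by positivity)
  set c₄ := η₀ ^ 2 / (12800 * Real.pi ^ 4) with hc₄
  have hc₄pos : 0 < c₄ := by positivity
  -- The bias is at most η/2 exactly when n^(1-κ) ≥ L. For smaller n the prefactor exp(c₄ L) makes
  -- the claimed bound at least 1.
  set L := 400 * Real.pi ^ 2 / η₀ with hL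
  have hLpos : 0 < L := by positivity
  refine ⟨6 * Real.exp (c₄ * L), by positivity, c₄, hc₄pos, ?_⟩
  intro n hn P _ hP hsig Ω _ μ _ W hW hind
  have hn1 : (1 : ℝ) ≤ n := by exact_mod_cast hn
  have hn0 : (0 : ℝ) < n := by linarith
  rcases lt_or_ge ((n : ℝ) ^ (1 - κ)) L with hsmall | hlarge
  · have h1 : (n : ℝ) ^ (1 - 2 * κ) ≤ (n : ℝ) ^ (1 - κ) :=
      Real.rpow_le_rpow_of_exponent_le hn1 (by linarith)
    have h2 : 1 ≤ Real.exp (c₄ * L) * Real.exp (-c₄ * (n : ℝ) ^ (1 - 2 * κ)) := by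
      rw [← Real.exp_add]
      refine Real.one_le_exp ?_
      nlinarith [mul_le_mul_of_nonneg_left (h1.trans hsmall.le) hc₄pos.le]
    refine measureReal_le_one.trans ?_
    linarith
  · set η := η₀ * (n : ℝ) ^ (-κ) with hη
    have hpow : 0 < (n : ℝ) ^ (-κ) := Real.rpow_pos_of_pos hn0 _
    have hpow1 : (n : ℝ) ^ (-κ) ≤ 1 := Real.rpow_le_one_of_one_le_of_nonpos hn1 (by linarith)
    have hηpos : 0 < η := by positivity
    have hbias : 200 * Real.pi ^ 2 / n ≤ η / 2 := by
      rw [hL, div_le_iff₀ hη₀pos] at hlarge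
      have e1 : (n : ℝ) ^ (1 - κ) = n * (n : ℝ) ^ (-κ) := by
        rw [sub_eq_add_neg, Real.rpow_add hn0, Real.rpow_one]
      rw [e1] at hlarge
      rw [div_le_iff₀ hn0, hη]
      linarith
    have hexp : η ^ 2 * n / (12800 * Real.pi ^ 4) = c₄ * (n : ℝ) ^ (1 - 2 * κ) := by
      have e1 : (n : ℝ) ^ (1 - 2 * κ) = n * ((n : ℝ) ^ (-κ)) ^ 2 := by
        rw [← Real.rpow_natCast, ← Real.rpow_mul hn0.le, sub_eq_add_neg, Real.rpow_add hn0,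
          Real.rpow_one]
        congr 2
        push_cast
        ring
      rw [e1, hc₄, hη]
      ring
    have hfst : IsProbabilityMeasure P.fst := inferInstance
    have hsnd : IsProbabilityMeasure P.snd := inferInstance
    have hx : m ≤ popAngle (diagLaw P.fst) := (min_le_left _ _).trans (hlow₁ P.fst hP.1)
    have hy : m ≤ popAngle (diagLaw P.snd) := (min_le_right _ _).trans (hlow₂ P.snd hP.2)
    have hηm : 4 * η ≤ m := by
      have : η₀ ≤ m / 4 := min_le_right _ _
      nlinarith
    have hηa : 4 * η ≤ popAngle P := by
      rw [pcSq_eq hd he hP, le_div_iff₀ (mul_pos (Real.sqrt_pos.2 (hm0.trans_le hx))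
        (Real.sqrt_pos.2 (hm0.trans_le hy)))] at hsig
      have h1 : m ≤ √(popAngle (diagLaw P.fst)) * √(popAngle (diagLaw P.snd)) := by
        calc m = √m * √m := (Real.mul_self_sqrt hm0.le).symm
          _ ≤ _ := by gcongr
      have h2 : η₀ ≤ c₃ * m / 2 := min_le_left _ _
      calc 4 * η ≤ 4 * (c₃ * m / 2 * (n : ℝ) ^ (-κ)) := by rw [hη]; gcongr
        _ = 2 * c₃ * (n : ℝ) ^ (-κ) * m := by ring
        _ ≤ 2 * c₃ * (n : ℝ) ^ (-κ) * (√(popAngle (diagLaw P.fst)) *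
            √(popAngle (diagLaw P.snd))) := by gcongr
        _ ≤ _ := hsig
    have hdx : Measurable fun z : Euc d × Euc e => (z.1, z.1) := by fun_prop
    have hdy : Measurable fun z : Euc d × Euc e => (z.2, z.2) := by fun_prop
    have hlx : P.map (fun z => (z.1, z.1)) = diagLaw P.fst := by
      rw [diagLaw, Measure.fst, Measure.map_map (by fun_prop) measurable_fst]; rfl
    have hly : P.map (fun z => (z.2, z.2)) = diagLaw P.snd := by
      rw [diagLaw, Measure.snd, Measure.map_map (by fun_prop) measurable_snd]; rfl
    -- The numerator and both denominators are sample covariances, the latter of diagonal pairs.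
    -- Three two-sided bounds account for the factor 6.
    have b1 := measure_samplePcovSq_sub_ge_le hn hW hind hηpos hbias
    have b2 := measure_samplePcovSq_sub_ge_le hn (P := diagLaw P.fst)
      (fun i => hlx ▸ hasLaw_comp (hW i) hdx) (hind.comp (fun _ z => (z.1, z.1)) fun _ => hdx)
      hηpos hbias
    have b3 := measure_samplePcovSq_sub_ge_le hn (P := diagLaw P.snd)
      (fun i => hly ▸ hasLaw_comp (hW i) hdy) (hind.comp (fun _ z => (z.2, z.2)) fun _ => hdy)
      hηpos hbias
    rw [hexp] at b1 b2 b3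
    have hsub : {ω | samplePcSq (fun i => (W i ω).1) (fun i => (W i ω).2) < pcSq P / 2} ⊆
        {ω | η ≤ |samplePcovSq (fun i => (W i ω).1) (fun i => (W i ω).2) - popAngle P|} ∪
        ({ω | η ≤ |samplePcovSq (fun i => (W i ω).1) (fun i => (W i ω).1)
            - popAngle (diagLaw P.fst)|} ∪
        {ω | η ≤ |samplePcovSq (fun i => (W i ω).2) (fun i => (W i ω).2)
            - popAngle (diagLaw P.snd)|}) := by
      intro ω hω
      by_contra hnot
      simp only [Set.mem_union, Set.mem_ofPred_eq, not_or, not_le] at hnot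
      simp only [Set.mem_ofPred_eq] at hω
      refine absurd hω (not_lt.2 ?_)
      rw [pcSq_eq hd he hP]
      exact half_ratio_le hηpos hx hy hηm hηa hnot.1 hnot.2.1 hnot.2.2
    have hu := (measureReal_mono (μ := μ) hsub).trans ((measureReal_union_le _ _).trans
      (add_le_add_right (measureReal_union_le _ _) _))
    have hE : 1 ≤ Real.exp (c₄ * L) := Real.one_le_exp (by positivity)
    rw [neg_mul]
    have hp := Real.exp_pos (-(c₄ * (n : ℝ) ^ (1 - 2 * κ)))
    refine (hu.trans (add_le_add b1 (add_le_add b2 b3))).trans ?_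
    nlinarith

/-! ### From one pair to the screening of all features -/

lemma measurable_scalar : Measurable scalar := by
  unfold scalar
  fun_prop

lemma measurable_featurePair {p q : ℕ} (k : Fin p) :
    Measurable fun z : (Fin p → ℝ) × Euc q => (scalar (z.1 k), z.2) :=
  (measurable_scalar.comp (by fun_prop)).prodMk measurable_snd

/-- The joint law of the `k`-th feature and the response. -/
def featurePairLaw {p q : ℕ} (P : Measure ((Fin p → ℝ) × Euc q)) (k : Fin p) :
    Measure (Euc 1 × Euc q) :=
  P.map (fun z => (scalar (z.1 k), z.2))

instance {p q : ℕ} (P : Measure ((Fin p → ℝ) × Euc q)) [IsProbabilityMeasure P] (k : Fin p) :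
    IsProbabilityMeasure (featurePairLaw P k) :=
  Measure.isProbabilityMeasure_map (measurable_featurePair k).aemeasurable

lemma noAtomMarginals_featurePairLaw {p q : ℕ} {P : Measure ((Fin p → ℝ) × Euc q)}
    (h : NoTies P) {k : Fin p} (hk : k ∈ activeSet P) : NoAtomMarginals (featurePairLaw P k) := by
  constructor
  · intro v
    rw [featurePairLaw, Measure.fst, Measure.map_map measurable_fst (measurable_featurePair k)]
    exact h.feature k hk v
  · intro v
    rw [featurePairLaw, Measure.snd, Measure.map_map measurable_snd (measurable_featurePair k)]
    exact h.response v

end PCScreen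

end

theorem theorem2 (q : ℕ) (σ₀ c₃ κ : ℝ) (hσ₀ : 0 < σ₀) (hc₃ : 0 < c₃)
    (hκ₀ : 0 ≤ κ) (hκ : κ < 1 / 2) :
    ∃ C > (0 : ℝ), ∃ c₄ > (0 : ℝ),
      ∀ (n p : ℕ), 1 ≤ n →
      ∀ (P : Measure ((Fin p → ℝ) × PCScreen.Euc q)) [IsProbabilityMeasure P],
      PCScreen.NoTies P → PCScreen.Nondegenerate σ₀ P → PCScreen.MinSignal c₃ κ n P →
      ∀ δ : ℝ, (∀ k ∈ PCScreen.activeSet P, δ ≤ PCScreen.omega P k / 2) →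
      ∀ {Ω : Type*} [MeasurableSpace Ω] (μ : Measure Ω) [IsProbabilityMeasure μ]
        (Z : Fin n → Ω → (Fin p → ℝ) × PCScreen.Euc q),
      (∀ i, HasLaw (Z i) P μ) → iIndepFun Z μ →
      1 - C * ((PCScreen.activeSet P).card * Real.exp (-c₄ * (n : ℝ) ^ (1 - 2 * κ)))
        ≤ μ.real {ω | PCScreen.activeSet P ⊆ PCScreen.screenedSet (fun i => Z i ω) δ} := by
  open PCScreen in
  -- In dimension 0 the response is a single point, hence an atom, so the hypotheses are
  -- contradictory and any constants serve.
  rcases Nat.eq_zero_or_pos q with rfl | hq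
  · refine ⟨1, one_pos, 1, one_pos, fun n p _ P _ hties => ?_⟩
    have h := hties.response 0
    rw [show ({0} : Set (Euc 0)) = Set.univ from Set.eq_univ_of_forall fun x =>
      Subsingleton.elim x 0, measure_univ] at h
    exact absurd h one_ne_zero
  obtain ⟨C, hC, c₄, hc₄, hbound⟩ := exists_measure_samplePcSq_lt_le 1 q le_rfl hq hc₃ hκ₀
  refine ⟨C, hC, c₄, hc₄, ?_⟩
  intro n p hn P _ hties _ hsig δ hδ Ω _ μ _ Z hZ hind
  have hk : ∀ k ∈ activeSet P, μ.real {ω | omegaHat (fun i => Z i ω) k < omega P k / 2}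
      ≤ C * Real.exp (-c₄ * (n : ℝ) ^ (1 - 2 * κ)) := fun k hk =>
    hbound n hn (featurePairLaw P k) (noAtomMarginals_featurePairLaw hties hk) (hsig k hk) μ
      (fun i ω => (scalar ((Z i ω).1 k), (Z i ω).2))
      (fun i => hasLaw_comp (hZ i) (measurable_featurePair k))
      (hind.comp (fun _ z => (scalar (z.1 k), z.2)) fun _ => measurable_featurePair k)
  -- A missed active feature has sample correlation below δ, hence below half of its population
  -- value.
  have hcover : (Set.univ : Set Ω) ⊆
      {ω | activeSet P ⊆ screenedSet (fun i => Z i ω) δ} ∪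
        ⋃ k ∈ activeSet P, {ω | omegaHat (fun i => Z i ω) k < omega P k / 2} := by
    intro ω _
    by_cases h : activeSet P ⊆ screenedSet (fun i => Z i ω) δ
    · exact Or.inl h
    · obtain ⟨k, hkA, hkS⟩ := Finset.not_subset.1 h
      refine Or.inr (Set.mem_iUnion₂.2 ⟨k, hkA, ?_⟩)
      have : ¬ δ ≤ omegaHat (fun i => Z i ω) k := fun h' =>
        hkS (Finset.mem_filter.2 ⟨Finset.mem_univ _, h'⟩)
      rw [Set.mem_ofPred_eq]
      exact (not_le.1 this).trans_le (hδ k hkA)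
  have h1 := (measureReal_mono (μ := μ) hcover).trans (measureReal_union_le _ _)
  rw [probReal_univ] at h1
  have h2 := (measureReal_biUnion_finset_le (μ := μ) (activeSet P)
    fun k => {ω | omegaHat (fun i => Z i ω) k < omega P k / 2}).trans (Finset.sum_le_sum hk)
  rw [Finset.sum_const, nsmul_eq_mul] at h2
  linarith
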